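/- Let $\mathcal M_1(\mathbb C)$ be the set of Borel probability measures on $\mathbb C$ with the weak topology, $D=\{|z|<1\}$, $m$ Lebesgue measure on $\mathbb C$ and $m_{\{|z|=1\}}$ the normalized arc length measure on the unit circle. Write $$U_\nu(z)=\int\log|z-w|\,d\nu(w),\qquad \Sigma(\sigma)=\iint\log|z-w|\,d\sigma(z)\,d\sigma(w),$$ and, for $\alpha>0$, $$I_\alpha(\nu)=B_\alpha(\nu)-\Sigma(\nu),\qquad B_\alpha(\nu)=2\sup_{w\in\mathbb C}\Big\{U_\nu(w)-\frac{|w|^2}{2\alpha}\Big\}.$$ The functional $I_\alpha$, with values in $(-\infty,+\infty]$, is considered on all $\nu\in\mathcal M_1(\mathbb C)$ with $\int\log(1+|w|)\,d\nu(w)<\infty$ (for other $\nu$ the expression is of the form $\infty-\infty$ or undefined; compactly supported measures are included). Minimizing $I_\alpha$ over $\mathcal C\subset\mathcal M_1(\mathbb C)$ means minimizing over those $\nu\in\mathcal C$. A measure $\mu$ has finite logarithmic energy if $|\Sigma(\mu)|<\infty$; this implies $\int\log(1+|w|)\,d\mu<\infty$. Put $$\mathcal F_p=\{\nu\in\mathcal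 M_1(\mathbb C):\nu(D)\le p/\alpha\},\qquad \mathcal M_p=\{\nu\in\mathcal M_1(\mathbb C):\nu(\overline D)\ge p/\alpha\}.$$ For $\alpha>0$ and $p\ge 0$ these sets are closed and convex. With $0\log 0=0$, the following hold. (1) Let $0\le p<1$. The equation $q(\log q-1)=p(\log p-1)$ has exactly one solution $q>1$. If $\alpha\ge q$, then $I_\alpha$ has a unique minimizer over $\mathcal F_p$, namely $$\mu_{Z_p}^\alpha=\frac1\alpha\big[\mathbf 1_{\{|z|\le\sqrt p\}}+\mathbf 1_{\{\sqrt q\le|z|\le\sqrt\alpha\}}\big]\frac{m}{\pi}+\frac{q-p}{\alpha}\,m_{\{|z|=1\}},$$ and $B_\alpha(\mu_{Z_p}^\alpha)=\log\alpha-1$, $$I_\alpha(\mu_{Z_p}^\alpha)=\frac{\log\alpha}2-\frac34+\frac{q^2(2\log q-1)}{4\alpha^2}-\frac{p^2(2\log p-1)}{4\alpha^2}.$$ (2) Let $1<p<e$. The equation $q(\log q-1)=p(\log p-1)$ has exactly one solution $q\in(0,1)$. If $\alpha>p$, then $I_\alpha$ has a unique minimizer over $\mathcal M_p$, namely $$\mu_{Z_p}^\alpha=\frac1\alpha\big[\mathbf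 1_{\{|z|\le\sqrt q\}}+\mathbf 1_{\{\sqrt p\le|z|\le\sqrt\alpha\}}\big]\frac{m}{\pi}+\frac{p-q}{\alpha}\,m_{\{|z|=1\}},$$ and $$I_\alpha(\mu_{Z_p}^\alpha)=\frac{\log\alpha}2-\frac34+\frac{p^2(2\log p-1)}{4\alpha^2}-\frac{q^2(2\log q-1)}{4\alpha^2}.$$ (3) Let $e\le p<\alpha$. Then $I_\alpha$ has a unique minimizer over $\mathcal M_p$, namely $$\mu_{Z_p}^\alpha=\frac p\alpha\,m_{\{|z|=1\}}+\frac1\alpha\mathbf 1_{\{\sqrt p\le|z|\le\sqrt\alpha\}}\frac m\pi,\qquad I_\alpha(\mu_{Z_p}^\alpha)=\frac{\log\alpha}2-\frac34+\frac{p^2(2\log p-1)}{4\alpha^2}.$$ (4) Let $\alpha>0$, let $\mathcal C\subset\mathcal M_1(\mathbb C)$ be closed and convex, and let $\mu_{\min}\in\mathcal C$ be a minimizer of $I_\alpha$ over $\mathcal C$ with finite logarithmic energy. A measure $\mu\in\mathcal C$ with finite logarithmic energy satisfies $$\int U_\nu\,d\mu-\frac{B_\alpha(\nu)}2\le\int U_\mu\,d\mu-\frac{B_\alpha(\mu)}2\quad\text{for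 all }\nu\in\mathcal C\text{ with finite logarithmic energy}$$ if and only if $\mu=\mu_{\min}$. Moreover, for every $\nu\in\mathcal C$ with finite logarithmic energy, $$-\Sigma(\nu-\mu_{\min})\le I_\alpha(\nu)-I_\alpha(\mu_{\min}).$$ (For $\nu\in\mathcal C$ with $\int\log(1+|w|)\,d\nu<\infty$ and $\Sigma(\nu)=-\infty$ the right-hand side is $+\infty$.) -/

import Mathlib

open MeasureTheory Set
open scoped ENNReal NNReal

noncomputable section

namespace LogEnergy

/-- The integral `∫ f dμ = ∫ f⁺ dμ - ∫ f⁻ dμ` of an extended real valued function. It is only used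
where at least one of the two parts has a finite integral. -/
def eintegral {X : Type*} [MeasurableSpace X] (μ : Measure X) (f : X → EReal) : EReal :=
  ((∫⁻ x, (f x).toENNReal ∂μ : ℝ≥0∞) : EReal) - ((∫⁻ x, (-f x).toENNReal ∂μ : ℝ≥0∞) : EReal)

/-- The logarithmic kernel `log |z - w|`, equal to `-∞` on the diagonal. -/
def logKernel (z w : ℂ) : EReal := ENNReal.log (edist z w)

/-- The logarithmic potential `U_ν(z) = ∫ log |z - w| dν(w)`. -/
def logPotential (ν : Measure ℂ) (z : ℂ) : EReal := eintegral ν (fun w => logKernel z w)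

/-- The mutual energy `∫∫ log |z - w| dμ(z) dν(w)`. -/
def mutualEnergy (μ ν : Measure ℂ) : EReal :=
  eintegral (μ.prod ν) (fun x => logKernel x.1 x.2)

/-- The logarithmic energy `Σ(μ) = ∫∫ log |z - w| dμ(z) dμ(w)`. -/
def logEnergy (μ : Measure ℂ) : EReal := mutualEnergy μ μ

/-- The logarithmic energy `Σ(σ) = ∫∫ log |z - w| dσ(z) dσ(w)` of a signed measure, where `dσ dσ` is
expanded by means of the Jordan decomposition `σ = σ⁺ - σ⁻`. -/
def signedLogEnergy (σ : SignedMeasure ℂ) : EReal :=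
  let P := σ.toJordanDecomposition.posPart
  let N := σ.toJordanDecomposition.negPart
  logEnergy P + logEnergy N - 2 * mutualEnergy P N

/-- `|Σ(μ)| < ∞`. -/
def FiniteLogEnergy (μ : Measure ℂ) : Prop := logEnergy μ ≠ ⊥ ∧ logEnergy μ ≠ ⊤

/-- `∫ log (1 + |z|) dμ(z) < ∞`. Among probability measures these (in particular all compactly
supported ones) are those for which `I_α` below is well defined: otherwise `B_α(ν) = +∞` while `Σ(ν)` is either `+∞`
or undefined. -/
def HasLogMoment (μ : Measure ℂ) : Prop := Integrable (fun z : ℂ => Real.log (1 + ‖z‖)) μ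

/-- `B_α(ν) = 2 sup_w { U_ν(w) - |w|² / (2α) }`. -/
def supTerm (α : ℝ) (ν : Measure ℂ) : EReal :=
  2 * ⨆ w : ℂ, (logPotential ν w - ((‖w‖ ^ 2 / (2 * α) : ℝ) : EReal))

/-- `I_α(ν) = B_α(ν) - Σ(ν)`, with values in `(-∞, +∞]` on measures with finite logarithmic
moment. -/
def energyFunctional (α : ℝ) (ν : Measure ℂ) : EReal := supTerm α ν - logEnergy ν

/-- `μ` minimizes `I_α` over (the members with finite logarithmic moment of) `C`. -/
def IsMinimizer (α : ℝ) (C : Set (ProbabilityMeasure ℂ)) (μ : ProbabilityMeasure ℂ) : Prop :=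
  μ ∈ C ∧ HasLogMoment μ ∧
    ∀ ν ∈ C, HasLogMoment ν → energyFunctional α μ ≤ energyFunctional α ν

/-- `μ` is the unique minimizer of `I_α` over `C`. -/
def IsUniqueMinimizer (α : ℝ) (C : Set (ProbabilityMeasure ℂ)) (μ : ProbabilityMeasure ℂ) : Prop :=
  IsMinimizer α C μ ∧ ∀ ν, IsMinimizer α C ν → ν = μ

/-- Convexity of a set of probability measures. -/
def IsConvexFamily (C : Set (ProbabilityMeasure ℂ)) : Prop :=
  Convex ℝ≥0 ((fun μ : ProbabilityMeasure ℂ => (μ : Measure ℂ)) '' C)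

/-- `F_p`: at most `p / α` mass in the open unit disk. -/
def fewFamily (α p : ℝ) : Set (ProbabilityMeasure ℂ) :=
  {ν | (ν : Measure ℂ).real (Metric.ball 0 1) ≤ p / α}

/-- `M_p`: at least `p / α` mass in the closed unit disk. -/
def manyFamily (α p : ℝ) : Set (ProbabilityMeasure ℂ) :=
  {ν | p / α ≤ (ν : Measure ℂ).real (Metric.closedBall 0 1)}

/-- Normalized arc length on the unit circle. -/
def circleUniform : Measure ℂ :=
  ENNReal.ofReal (1 / (2 * Real.pi)) •
    (volume.restrict (Ioc 0 (2 * Real.pi))).map (circleMap 0 1)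

/-- The radial measure
`(1/α) [1_{|z| ≤ √a} + 1_{√b ≤ |z| ≤ √α}] m / π + ((b - a)/α) m_{|z| = 1}`. -/
def radialMeasure (α a b : ℝ) : Measure ℂ :=
  ENNReal.ofReal (1 / (α * Real.pi)) •
      (volume.restrict {z : ℂ | ‖z‖ ≤ √a} + volume.restrict {z : ℂ | √b ≤ ‖z‖ ∧ ‖z‖ ≤ √α}) +
    ENNReal.ofReal ((b - a) / α) • circleUniform

end LogEnergy

end

/-! Two facts carry the theorem. The first is that `-Σ` is strictly positive definite on differences
of probability measures: `Σ(μ) + Σ(ν) ≤ 2 ∫∫ log |z - w| dμ dν` whenever both energies are finite,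
with equality only for `μ = ν` (`realEnergy_add_le_two_mul`, `eq_of_two_mul_realEnergy_le`). By
Frullani, `-log a` is the integral over `t > 0` of `(e^{-ta} - e^{-t}) / t`. With `a = |z - w|²` the
claim becomes positivity for each Gaussian kernel, which is a weighted `L²` norm of the difference
of characteristic functions.

The second is a linear inequality. By the first fact, `μ` is the unique minimizer once `∫ U_μ dν -
B_α(ν)/2 ≤ Σ(μ) - B_α(μ)/2` for all competitors `ν`, because twice this inequality reads `2 ∫ U_μ dν
- Σ(ν) - Σ(μ) ≤ I_α(ν) - I_α(μ)`. For a radial candidate the inequality comes from moving the mass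
on the unit circle to radius `t`, with `t² = p`, the edge of the forbidden region that depends on
the constraint. Integrating `U_ν(w) ≤ |w|²/(2α) + B_α(ν)/2` against the shifted measure controls one
term. The difference between the two circles is `∫ log (max |z| 1 / max |z| t) dν`, and this is
where the mass constraint enters. The equation `q (log q - 1) = p (log p - 1)` makes the candidate's
potential touch the obstacle `|z|²/(2α) + (log α - 1)/2` on the inner disc as well as on the outer
annulus. When `p ≥ e` the inner disc is empty and only an inequality is left.

For a general convex family, the linear inequality is the first-order condition at a minimizer:
`B_α` is convex and `Σ` is quadratic along segments. -/

namespace LogEnergy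

/-! ### Integrals of extended real functions -/

section EIntegral

variable {X : Type*} [MeasurableSpace X] {μ : Measure X} {f : X → EReal}

lemma toReal_toENNReal_sub (x : EReal) :
    x.toENNReal.toReal - (-x).toENNReal.toReal = x.toReal := by
  induction x with
  | bot => simp
  | top => simp
  | coe r =>
    rw [← EReal.coe_neg, EReal.toENNReal_of_ne_top (EReal.coe_ne_top _),
      EReal.toENNReal_of_ne_top (EReal.coe_ne_top _), EReal.toReal_coe, EReal.toReal_coe]
    rcases le_total 0 r with h | h
    · simp [h, ENNReal.ofReal_of_nonpos (neg_nonpos.2 h)]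
    · simp [h, ENNReal.ofReal_of_nonpos h]

lemma eintegral_congr_ae {g : X → EReal} (h : f =ᵐ[μ] g) : eintegral μ f = eintegral μ g := by
  unfold eintegral
  have h1 : ∫⁻ x, (f x).toENNReal ∂μ = ∫⁻ x, (g x).toENNReal ∂μ :=
    lintegral_congr_ae (h.fun_comp EReal.toENNReal)
  have h2 : ∫⁻ x, (-f x).toENNReal ∂μ = ∫⁻ x, (-g x).toENNReal ∂μ :=
    lintegral_congr_ae (h.fun_comp fun x => (-x).toENNReal)
  rw [h1, h2]

lemma eintegral_coe {g : X → ℝ} (hg : Integrable g μ) :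
    eintegral μ (fun x => (g x : EReal)) = ((∫ x, g x ∂μ : ℝ) : EReal) := by
  unfold eintegral
  have h1 : ∀ r : ℝ, (r : EReal).toENNReal = ENNReal.ofReal r := fun r => by
    rw [EReal.toENNReal_of_ne_top (EReal.coe_ne_top _), EReal.toReal_coe]
  simp only [← EReal.coe_neg, h1]
  rw [integral_eq_lintegral_pos_part_sub_lintegral_neg_part hg, EReal.coe_sub,
    EReal.coe_ennreal_toReal hg.lintegral_lt_top.ne,
    EReal.coe_ennreal_toReal (by simpa using hg.neg.lintegral_lt_top.ne)]

lemma eintegral_eq_coe_of_ae {g : X → ℝ} (hg : Integrable g μ)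
    (h : ∀ᵐ x ∂μ, f x = (g x : EReal)) :
    eintegral μ f = ((∫ x, g x ∂μ : ℝ) : EReal) := by
  rw [eintegral_congr_ae h, eintegral_coe hg]

lemma ae_ne_bot_and_integrable_toReal (hf : Measurable f)
    (h1 : ∫⁻ x, (f x).toENNReal ∂μ ≠ ⊤) (h2 : ∫⁻ x, (-f x).toENNReal ∂μ ≠ ⊤) :
    (∀ᵐ x ∂μ, f x ≠ ⊥) ∧ Integrable (fun x => (f x).toReal) μ := by
  have m1 : Measurable fun x => (f x).toENNReal := hf.ereal_toENNReal
  have m2 : Measurable fun x => (-f x).toENNReal := hf.neg.ereal_toENNReal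
  refine ⟨?_, ?_⟩
  · filter_upwards [ae_lt_top m2 h2] with x hx hb
    simp [hb] at hx
  · refine ((MeasureTheory.integrable_toReal_of_lintegral_ne_top m1.aemeasurable h1).sub
      (MeasureTheory.integrable_toReal_of_lintegral_ne_top m2.aemeasurable h2)).congr ?_
    exact ae_of_all _ fun x => toReal_toENNReal_sub (f x)

/-- In `EReal` one has `x - ⊤ = ⊥` even for `x = ⊤`. A value other than `⊥` therefore bounds the
negative part first, and the positive part follows. -/
lemma eintegral_finite (hf : Measurable f) (h1 : eintegral μ f ≠ ⊥) (h2 : eintegral μ f ≠ ⊤) :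
    (∀ᵐ x ∂μ, f x ≠ ⊥) ∧ Integrable (fun x => (f x).toReal) μ := by
  unfold eintegral at h1 h2
  have hB : ∫⁻ x, (-f x).toENNReal ∂μ ≠ ⊤ := by
    intro h
    rw [h] at h1
    simp at h1
  refine ae_ne_bot_and_integrable_toReal hf ?_ hB
  intro h
  rw [h] at h2
  apply h2
  rw [EReal.coe_ennreal_top]
  apply EReal.top_sub
  simpa using hB

/-- A function with finite positive part is either integrable or has integral `⊥`. This dichotomy
lets later arguments work with real numbers and treat `⊥` separately. -/
lemma eintegral_eq_bot (hf : Measurable f) (h1 : ∫⁻ x, (f x).toENNReal ∂μ ≠ ⊤)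
    (h : ¬ ((∀ᵐ x ∂μ, f x ≠ ⊥) ∧ Integrable (fun x => (f x).toReal) μ)) :
    eintegral μ f = ⊥ := by
  have hB : ∫⁻ x, (-f x).toENNReal ∂μ = ⊤ := by
    by_contra h2
    exact h (ae_ne_bot_and_integrable_toReal hf h1 h2)
  unfold eintegral
  rw [hB]
  simp

end EIntegral

/-! ### The logarithmic kernel and bilinearity of the mutual energy -/

section Kernel

lemma logKernel_self (z : ℂ) : logKernel z z = ⊥ := by simp [logKernel]

lemma logKernel_of_ne {z w : ℂ} (h : z ≠ w) : logKernel z w = (Real.log ‖z - w‖ : EReal) := by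
  rw [logKernel, edist_dist, ENNReal.log_ofReal_of_pos (dist_pos.2 h), dist_eq_norm]

lemma logKernel_ne_bot_iff {z w : ℂ} : logKernel z w ≠ ⊥ ↔ z ≠ w := by
  simp [logKernel]

lemma toReal_logKernel (z w : ℂ) : (logKernel z w).toReal = Real.log ‖z - w‖ := by
  by_cases h : z = w
  · simp [h, logKernel_self]
  · rw [logKernel_of_ne h, EReal.toReal_coe]

lemma measurable_logKernel : Measurable fun x : ℂ × ℂ => logKernel x.1 x.2 := by
  unfold logKernel
  exact ENNReal.measurable_log.comp (measurable_fst.edist measurable_snd)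

/-- From `|z - w| ≤ (1 + |z|)(1 + |w|)`. Under logarithmic moments the positive part of the kernel
is thus integrable, and energies can only diverge to `-∞`. -/
lemma log_norm_sub_le (z w : ℂ) :
    Real.log ‖z - w‖ ≤ Real.log (1 + ‖z‖) + Real.log (1 + ‖w‖) := by
  have hz := norm_nonneg z
  have hw := norm_nonneg w
  rw [← Real.log_mul (by positivity) (by positivity)]
  rcases eq_or_ne z w with rfl | h
  · simp only [sub_self, norm_zero, Real.log_zero]
    exact Real.log_nonneg (by nlinarith)
  · refine Real.log_le_log (norm_pos_iff.2 (sub_ne_zero.2 h)) ?_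
    nlinarith [norm_sub_le z w]

lemma toENNReal_logKernel_le (z w : ℂ) :
    (logKernel z w).toENNReal ≤
      ENNReal.ofReal (Real.log (1 + ‖z‖) + Real.log (1 + ‖w‖)) := by
  by_cases h : z = w
  · simp [h, logKernel_self]
  · rw [logKernel_of_ne h, EReal.toENNReal_of_ne_top (EReal.coe_ne_top _), EReal.toReal_coe]
    exact ENNReal.ofReal_le_ofReal (log_norm_sub_le z w)

/-- The logarithmic kernel is integrable with respect to `μ × ν`, and the diagonal, where the
kernel is `-∞`, is a null set. -/
structure LogIntegrable (μ ν : Measure ℂ) : Prop where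
  ne : ∀ᵐ x ∂μ.prod ν, x.1 ≠ x.2
  integrable : Integrable (fun x : ℂ × ℂ => Real.log ‖x.1 - x.2‖) (μ.prod ν)

/-- The logarithmic potential of `ν` at `z` is a real number, given by an absolutely convergent
integral. -/
def PotentialFinite (ν : Measure ℂ) (z : ℂ) : Prop :=
  (∀ᵐ w ∂ν, z ≠ w) ∧ Integrable (fun w => Real.log ‖z - w‖) ν

/-- The real valued mutual energy, meaningful when `LogIntegrable μ ν` holds. -/
noncomputable def realEnergy (μ ν : Measure ℂ) : ℝ := ∫ x, Real.log ‖x.1 - x.2‖ ∂μ.prod ν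

/-- The real valued potential. -/
noncomputable def realPotential (ν : Measure ℂ) (z : ℂ) : ℝ := ∫ w, Real.log ‖z - w‖ ∂ν

variable {μ ν : Measure ℂ}

lemma measurable_log_norm_sub : Measurable fun x : ℂ × ℂ => Real.log ‖x.1 - x.2‖ := by fun_prop

lemma LogIntegrable.mutualEnergy_eq (h : LogIntegrable μ ν) :
    mutualEnergy μ ν = (realEnergy μ ν : EReal) := by
  refine eintegral_eq_coe_of_ae h.integrable ?_
  filter_upwards [h.ne] with x hx
  exact logKernel_of_ne hx

lemma logIntegrable_of_finite (h1 : mutualEnergy μ ν ≠ ⊥) (h2 : mutualEnergy μ ν ≠ ⊤) :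
    LogIntegrable μ ν := by
  obtain ⟨h3, h4⟩ := eintegral_finite measurable_logKernel h1 h2
  simp only [toReal_logKernel] at h4
  exact ⟨h3.mono fun x hx => logKernel_ne_bot_iff.1 hx, h4⟩

lemma HasLogMoment.integrable_fst [SFinite μ] [IsFiniteMeasure ν] (h : HasLogMoment μ) :
    Integrable (fun x : ℂ × ℂ => Real.log (1 + ‖x.1‖)) (μ.prod ν) :=
  Integrable.comp_fst h ν

lemma HasLogMoment.integrable_snd [SFinite ν] [IsFiniteMeasure μ] (h : HasLogMoment ν) :
    Integrable (fun x : ℂ × ℂ => Real.log (1 + ‖x.2‖)) (μ.prod ν) :=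
  Integrable.comp_snd h μ

lemma mutualEnergy_eq_bot [IsFiniteMeasure μ] [IsFiniteMeasure ν] (hμ : HasLogMoment μ)
    (hν : HasLogMoment ν) (h : ¬ LogIntegrable μ ν) : mutualEnergy μ ν = ⊥ := by
  refine eintegral_eq_bot measurable_logKernel ?_ ?_
  · refine ne_top_of_le_ne_top ?_ (lintegral_mono fun x => toENNReal_logKernel_le x.1 x.2)
    exact (hμ.integrable_fst.add hν.integrable_snd).lintegral_lt_top.ne
  · rintro ⟨h1, h2⟩
    simp only [toReal_logKernel] at h2
    exact h ⟨h1.mono fun x hx => logKernel_ne_bot_iff.1 hx, h2⟩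

lemma logPotential_eq {z : ℂ} (h : PotentialFinite ν z) :
    logPotential ν z = (realPotential ν z : EReal) := by
  refine eintegral_eq_coe_of_ae h.2 ?_
  filter_upwards [h.1] with x hx
  exact logKernel_of_ne hx

lemma logPotential_eq_bot [IsFiniteMeasure ν] (hν : HasLogMoment ν) {z : ℂ}
    (h : ¬ PotentialFinite ν z) : logPotential ν z = ⊥ := by
  refine eintegral_eq_bot (measurable_logKernel.comp measurable_prodMk_left) ?_ ?_
  · refine ne_top_of_le_ne_top ?_ (lintegral_mono fun w => toENNReal_logKernel_le z w)
    exact ((integrable_const _).add hν).lintegral_lt_top.ne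
  · rintro ⟨h1, h2⟩
    simp only [toReal_logKernel] at h2
    exact h ⟨h1.mono fun x hx => logKernel_ne_bot_iff.1 hx, h2⟩

lemma LogIntegrable.ae_potential [SFinite μ] [SFinite ν] (h : LogIntegrable μ ν) :
    ∀ᵐ z ∂μ, PotentialFinite ν z := by
  filter_upwards [Measure.ae_ae_of_ae_prod h.ne, h.integrable.prod_right_ae] with z h1 h2
  exact ⟨h1, h2⟩

lemma LogIntegrable.ae_logPotential_eq [SFinite μ] [SFinite ν] (h : LogIntegrable μ ν) :
    ∀ᵐ z ∂μ, logPotential ν z = (realPotential ν z : EReal) := by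
  filter_upwards [h.ae_potential] with z hz
  exact logPotential_eq hz

lemma LogIntegrable.integrable_potential [SFinite μ] [SFinite ν] (h : LogIntegrable μ ν) :
    Integrable (realPotential ν) μ := h.integrable.integral_prod_left

lemma LogIntegrable.integral_potential [SFinite μ] [SFinite ν] (h : LogIntegrable μ ν) :
    ∫ z, realPotential ν z ∂μ = realEnergy μ ν := (integral_prod _ h.integrable).symm

lemma LogIntegrable.eintegral_logPotential [SFinite μ] [SFinite ν] (h : LogIntegrable μ ν) :
    eintegral μ (logPotential ν) = (realEnergy μ ν : EReal) := by
  rw [eintegral_eq_coe_of_ae h.integrable_potential h.ae_logPotential_eq, h.integral_potential]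

lemma LogIntegrable.symm [SFinite μ] [SFinite ν] (h : LogIntegrable μ ν) :
    LogIntegrable ν μ := by
  refine ⟨?_, ?_⟩
  · have := (Measure.measurePreserving_swap (μ := ν) (ν := μ)).quasiMeasurePreserving.ae h.ne
    exact this.mono fun x hx => Ne.symm hx
  · have := h.integrable.swap
    refine this.congr (ae_of_all _ fun x => ?_)
    simp [norm_sub_rev]

lemma realEnergy_comm [SFinite μ] [SFinite ν] : realEnergy μ ν = realEnergy ν μ := by
  unfold realEnergy
  rw [← integral_prod_swap]
  simp [norm_sub_rev]

lemma LogIntegrable.mono {μ' ν' : Measure ℂ} [SFinite μ'] [SFinite ν'] [SFinite ν]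
    (h : LogIntegrable μ ν) (h1 : μ' ≤ μ) (h2 : ν' ≤ ν) : LogIntegrable μ' ν' :=
  have := Measure.prod_mono h1 h2
  ⟨ae_mono this h.ne, h.integrable.mono_measure this⟩

lemma LogIntegrable.add_left {μ' : Measure ℂ} [SFinite μ] [SFinite μ'] [SFinite ν]
    (h : LogIntegrable μ ν) (h' : LogIntegrable μ' ν) : LogIntegrable (μ + μ') ν := by
  refine ⟨?_, ?_⟩
  · rw [Measure.add_prod, ae_add_measure_iff]
    exact ⟨h.ne, h'.ne⟩
  · rw [Measure.add_prod]
    exact h.integrable.add_measure h'.integrable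

lemma LogIntegrable.realEnergy_add_left {μ' : Measure ℂ} [SFinite μ] [SFinite μ'] [SFinite ν]
    (h : LogIntegrable μ ν) (h' : LogIntegrable μ' ν) :
    realEnergy (μ + μ') ν = realEnergy μ ν + realEnergy μ' ν := by
  unfold realEnergy
  rw [Measure.add_prod, integral_add_measure h.integrable h'.integrable]

lemma LogIntegrable.add_right {ν' : Measure ℂ} [SFinite μ] [SFinite ν'] [SFinite ν]
    (h : LogIntegrable μ ν) (h' : LogIntegrable μ ν') : LogIntegrable μ (ν + ν') :=
  (h.symm.add_left h'.symm).symm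

lemma LogIntegrable.realEnergy_add_right {ν' : Measure ℂ} [SFinite μ] [SFinite ν'] [SFinite ν]
    (h : LogIntegrable μ ν) (h' : LogIntegrable μ ν') :
    realEnergy μ (ν + ν') = realEnergy μ ν + realEnergy μ ν' := by
  rw [realEnergy_comm, h.symm.realEnergy_add_left h'.symm, realEnergy_comm (μ := ν),
    realEnergy_comm (μ := ν')]

lemma LogIntegrable.smul_left [SFinite μ] [SFinite ν] (h : LogIntegrable μ ν) {c : ℝ≥0∞}
    (hc : c ≠ ⊤) : LogIntegrable (c • μ) ν := by
  refine ⟨?_, ?_⟩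
  · rw [Measure.prod_smul_left]
    exact Measure.ae_smul_measure h.ne c
  · rw [Measure.prod_smul_left]
    exact h.integrable.smul_measure hc

lemma realEnergy_smul_left [SFinite μ] [SFinite ν] (c : ℝ≥0∞) :
    realEnergy (c • μ) ν = c.toReal * realEnergy μ ν := by
  unfold realEnergy
  rw [Measure.prod_smul_left, integral_smul_measure, smul_eq_mul]

lemma LogIntegrable.smul_right [SFinite μ] [SFinite ν] (h : LogIntegrable μ ν) {c : ℝ≥0∞}
    (hc : c ≠ ⊤) : LogIntegrable μ (c • ν) :=
  (h.symm.smul_left hc).symm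

lemma realEnergy_smul_right [SFinite μ] [SFinite ν] (c : ℝ≥0∞) :
    realEnergy μ (c • ν) = c.toReal * realEnergy μ ν := by
  rw [realEnergy_comm, realEnergy_smul_left, realEnergy_comm]

lemma log_one_add_norm_le (z w : ℂ) :
    Real.log (1 + ‖w‖) ≤ Real.log (1 + ‖z‖) + (Real.log 2 + |Real.log ‖z - w‖|) := by
  have hz := norm_nonneg z
  have hw := norm_nonneg w
  have hd := norm_nonneg (z - w)
  have h1 : ‖w‖ ≤ ‖z‖ + ‖z - w‖ := by
    have := norm_sub_le z (z - w)
    simpa using this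
  have h2 : Real.log (1 + ‖z - w‖) ≤ Real.log 2 + |Real.log ‖z - w‖| := by
    rcases le_total ‖z - w‖ 1 with h | h
    · have : Real.log (1 + ‖z - w‖) ≤ Real.log 2 :=
        Real.log_le_log (by positivity) (by linarith)
      linarith [abs_nonneg (Real.log ‖z - w‖)]
    · rw [abs_of_nonneg (Real.log_nonneg h), ← Real.log_mul (by norm_num) (by positivity)]
      exact Real.log_le_log (by positivity) (by linarith)
  have h3 : Real.log (1 + ‖w‖) ≤ Real.log ((1 + ‖z‖) * (1 + ‖z - w‖)) :=
    Real.log_le_log (by positivity) (by nlinarith)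
  rw [Real.log_mul (by positivity) (by positivity)] at h3
  linarith

lemma measurable_log_one_add_norm : Measurable fun z : ℂ => Real.log (1 + ‖z‖) := by fun_prop

lemma log_one_add_norm_nonneg (z : ℂ) : 0 ≤ Real.log (1 + ‖z‖) :=
  Real.log_nonneg (by linarith [norm_nonneg z])

/-- One point `z` with finite potential suffices: `|w| ≤ |z| + |z - w|` bounds `log (1 + |w|)` by a
constant plus `|log |z - w||`. -/
lemma LogIntegrable.hasLogMoment [IsFiniteMeasure ν] [SFinite μ] [NeZero μ]
    (h : LogIntegrable μ ν) : HasLogMoment ν := by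
  obtain ⟨z, -, hz⟩ := h.ae_potential.exists
  refine Integrable.mono' ((integrable_const (Real.log (1 + ‖z‖))).add
    ((integrable_const (Real.log 2)).add hz.abs)) measurable_log_one_add_norm.aestronglyMeasurable
    (ae_of_all _ fun w => ?_)
  rw [Real.norm_of_nonneg (log_one_add_norm_nonneg w)]
  exact log_one_add_norm_le z w

lemma FiniteLogEnergy.logIntegrable (h : FiniteLogEnergy μ) : LogIntegrable μ μ :=
  logIntegrable_of_finite h.1 h.2

end Kernel

end LogEnergy
namespace LogEnergy

/-! ### Positive definiteness of the Gaussian kernel -/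

section GaussianEnergy

open Complex ComplexConjugate RealInnerProductSpace Real

/-- The mutual energy for the Gaussian kernel `exp (-t |z - w|²)`. -/
noncomputable def gaussianEnergy (t : ℝ) (μ ν : Measure ℂ) : ℝ :=
  ∫ x, Real.exp (-(t * ‖x.1 - x.2‖ ^ 2)) ∂μ.prod ν

variable {μ ν : Measure ℂ}

lemma gaussianEnergy_comm [SFinite μ] [SFinite ν] (t : ℝ) :
    gaussianEnergy t μ ν = gaussianEnergy t ν μ := by
  unfold gaussianEnergy
  rw [← integral_prod_swap]
  simp [norm_sub_rev]

lemma charFun_mul_conj_charFun [IsFiniteMeasure μ] [IsFiniteMeasure ν] (ξ : ℂ) :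
    charFun μ ξ * conj (charFun ν ξ) =
      ∫ x, cexp (I * ⟪x.1 - x.2, ξ⟫) ∂μ.prod ν := by
  rw [charFun_apply, charFun_apply, ← integral_conj, ← integral_prod_mul]
  congr 1
  ext x
  rw [← exp_conj, ← Complex.exp_add, inner_sub_left]
  congr 1
  simp
  ring

lemma integrable_exp_neg_mul_norm_sq {s : ℝ} (hs : 0 < s) :
    Integrable fun ξ : ℂ => Real.exp (-s * ‖ξ‖ ^ 2) := by
  have := GaussianFourier.integrable_cexp_neg_mul_sq_norm_add (V := ℂ) (b := (s : ℂ))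
    (by simpa using hs) 0 0
  refine this.norm.congr (ae_of_all _ fun ξ => ?_)
  simp [Complex.norm_exp, ← Complex.ofReal_pow]

/-- Fubini reduces this to the Fourier transform of a Gaussian on the plane, which turns the
parameter `s` in frequency into `1 / (4 s)` in space. -/
lemma integral_gaussian_mul_charFun [IsFiniteMeasure μ] [IsFiniteMeasure ν] {s : ℝ} (hs : 0 < s) :
    ∫ ξ : ℂ, (Real.exp (-s * ‖ξ‖ ^ 2) : ℂ) * (charFun μ ξ * conj (charFun ν ξ)) =
      ((π / s * gaussianEnergy (1 / (4 * s)) μ ν : ℝ) : ℂ) := by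
  simp_rw [charFun_mul_conj_charFun, ← integral_const_mul]
  rw [integral_integral_swap]
  · have : ∀ x : ℂ × ℂ, ∫ ξ : ℂ, (Real.exp (-s * ‖ξ‖ ^ 2) : ℂ) * cexp (I * ⟪x.1 - x.2, ξ⟫) =
        ((π / s * Real.exp (-(1 / (4 * s) * ‖x.1 - x.2‖ ^ 2)) : ℝ) : ℂ) := by
      intro x
      have h := GaussianFourier.integral_cexp_neg_mul_sq_norm_add (V := ℂ) (b := (s : ℂ))
        (by simpa using hs) I (x.1 - x.2)
      rw [finrank_real_complex] at h
      -- The Gaussian integral carries the exponent `d / 2`, where `d = 2` is the real dimension of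
      -- `ℂ`.
      have e : ((2 : ℕ) : ℂ) / 2 = 1 := by norm_num
      rw [e, Complex.cpow_one] at h
      push_cast
      simp_rw [← Complex.exp_add]
      rw [h]
      congr 2
      rw [I_sq]
      have : (s : ℂ) ≠ 0 := by exact_mod_cast hs.ne'
      field_simp
    simp_rw [this]
    rw [integral_complex_ofReal, integral_const_mul]
    rfl
  · have h1 : Integrable (fun p : ℂ × (ℂ × ℂ) => Real.exp (-s * ‖p.1‖ ^ 2))
        (volume.prod (μ.prod ν)) := (integrable_exp_neg_mul_norm_sq hs).comp_fst _
    refine h1.mono' (Continuous.aestronglyMeasurable (by unfold Function.uncurry; fun_prop))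
      (ae_of_all _ fun p => ?_)
    simp only [Function.uncurry, norm_mul]
    rw [mul_comm I, Complex.norm_exp_ofReal_mul_I, mul_one, Complex.norm_real,
      Real.norm_of_nonneg (Real.exp_pos _).le]

lemma integrable_gaussian_mul_charFun [IsProbabilityMeasure μ] [IsProbabilityMeasure ν] {s : ℝ}
    (hs : 0 < s) :
    Integrable fun ξ : ℂ =>
      (Real.exp (-s * ‖ξ‖ ^ 2) : ℂ) * (charFun μ ξ * conj (charFun ν ξ)) := by
  refine (integrable_exp_neg_mul_norm_sq hs).mono' (Continuous.aestronglyMeasurable ?_)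
    (ae_of_all _ fun ξ => ?_)
  · have h1 : Continuous (charFun μ) := continuous_charFun
    have h2 : Continuous (charFun ν) := continuous_charFun
    fun_prop
  · rw [norm_mul, norm_mul, RCLike.norm_conj, Complex.norm_real,
      Real.norm_of_nonneg (Real.exp_pos _).le]
    have h1 := norm_charFun_le_one (μ := μ) ξ
    have h2 := norm_charFun_le_one (μ := ν) ξ
    have : ‖charFun μ ξ‖ * ‖charFun ν ξ‖ ≤ 1 := mul_le_one₀ h1 (norm_nonneg _) h2
    nlinarith [Real.exp_pos (-s * ‖ξ‖ ^ 2)]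

lemma integral_gaussian_mul_norm_charFun_sub_sq [IsProbabilityMeasure μ] [IsProbabilityMeasure ν]
    {s : ℝ} (hs : 0 < s) :
    (Integrable fun ξ : ℂ => Real.exp (-s * ‖ξ‖ ^ 2) * ‖charFun μ ξ - charFun ν ξ‖ ^ 2) ∧
    ∫ ξ : ℂ, Real.exp (-s * ‖ξ‖ ^ 2) * ‖charFun μ ξ - charFun ν ξ‖ ^ 2 =
      π / s * (gaussianEnergy (1 / (4 * s)) μ μ + gaussianEnergy (1 / (4 * s)) ν ν
        - 2 * gaussianEnergy (1 / (4 * s)) μ ν) := by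
  have i1 := integrable_gaussian_mul_charFun (μ := μ) (ν := μ) hs
  have i2 := integrable_gaussian_mul_charFun (μ := ν) (ν := ν) hs
  have i3 := integrable_gaussian_mul_charFun (μ := μ) (ν := ν) hs
  have i4 := integrable_gaussian_mul_charFun (μ := ν) (ν := μ) hs
  have e : ∀ ξ : ℂ, ((Real.exp (-s * ‖ξ‖ ^ 2) * ‖charFun μ ξ - charFun ν ξ‖ ^ 2 : ℝ) : ℂ) =
      (Real.exp (-s * ‖ξ‖ ^ 2) : ℂ) * (charFun μ ξ * conj (charFun μ ξ)) +
      (Real.exp (-s * ‖ξ‖ ^ 2) : ℂ) * (charFun ν ξ * conj (charFun ν ξ)) -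
      (Real.exp (-s * ‖ξ‖ ^ 2) : ℂ) * (charFun μ ξ * conj (charFun ν ξ)) -
      (Real.exp (-s * ‖ξ‖ ^ 2) : ℂ) * (charFun ν ξ * conj (charFun μ ξ)) := by
    intro ξ
    rw [Complex.ofReal_mul, Complex.ofReal_pow, ← Complex.mul_conj', map_sub]
    ring
  have i := ((i1.add i2).sub i3).sub i4
  refine ⟨?_, ?_⟩
  · refine i.re.congr (ae_of_all _ fun ξ => ?_)
    have := congrArg Complex.re (e ξ)
    rw [Complex.ofReal_re] at this
    exact this.symm
  · rw [← Complex.ofReal_inj, ← integral_complex_ofReal]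
    simp_rw [e]
    rw [integral_sub, integral_sub, integral_add i1 i2, integral_gaussian_mul_charFun hs,
      integral_gaussian_mul_charFun hs, integral_gaussian_mul_charFun hs,
      integral_gaussian_mul_charFun hs, gaussianEnergy_comm (μ := ν) (ν := μ)]
    · push_cast
      ring
    · exact i1.add i2
    · exact i3
    · exact (i1.add i2).sub i3
    · exact i4

/-- Up to a positive factor, the difference of the two sides is the integral of `|charFun μ -
charFun ν|²` against a Gaussian weight. -/
lemma two_mul_gaussianEnergy_le [IsProbabilityMeasure μ] [IsProbabilityMeasure ν] {t : ℝ}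
    (ht : 0 < t) :
    2 * gaussianEnergy t μ ν ≤ gaussianEnergy t μ μ + gaussianEnergy t ν ν := by
  obtain ⟨-, h⟩ := integral_gaussian_mul_norm_charFun_sub_sq (μ := μ) (ν := ν)
    (s := 1 / (4 * t)) (by positivity)
  have h0 : 0 ≤ ∫ ξ : ℂ, Real.exp (-(1 / (4 * t)) * ‖ξ‖ ^ 2) * ‖charFun μ ξ - charFun ν ξ‖ ^ 2 :=
    integral_nonneg fun ξ => by positivity
  have e : 1 / (4 * (1 / (4 * t))) = t := by field_simp
  rw [h, e] at h0
  have := nonneg_of_mul_nonneg_right h0 (by positivity)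
  linarith

/-- The weighted `L²` norm vanishes, so the characteristic functions agree almost everywhere; by
continuity they agree everywhere. -/
lemma eq_of_two_mul_gaussianEnergy_eq [IsProbabilityMeasure μ] [IsProbabilityMeasure ν] {t : ℝ}
    (ht : 0 < t)
    (h : 2 * gaussianEnergy t μ ν = gaussianEnergy t μ μ + gaussianEnergy t ν ν) : μ = ν := by
  obtain ⟨i, h'⟩ := integral_gaussian_mul_norm_charFun_sub_sq (μ := μ) (ν := ν)
    (s := 1 / (4 * t)) (by positivity)
  have e : 1 / (4 * (1 / (4 * t))) = t := by field_simp
  rw [e, h, sub_self, mul_zero, integral_eq_zero_iff_of_nonneg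
    (fun ξ => by simp only [Pi.zero_apply]; positivity) i] at h'
  have h1 : Continuous (charFun μ) := continuous_charFun
  have h2 : Continuous (charFun ν) := continuous_charFun
  have := (Continuous.ae_eq_iff_eq (μ := volume) (by fun_prop) (by fun_prop)).1 h'
  refine Measure.ext_of_charFun (funext fun ξ => ?_)
  have h3 := congrFun this ξ
  simp only [Pi.zero_apply, mul_eq_zero, Real.exp_ne_zero, false_or] at h3
  exact sub_eq_zero.1 (norm_eq_zero.1 (pow_eq_zero_iff (two_ne_zero) |>.1 h3))

end GaussianEnergy

end LogEnergy
namespace LogEnergy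

/-! ### From Gaussian to logarithmic energy by Frullani's integral -/

section PositiveDefinite

/-- The integrand `(e^{-ta} - e^{-t}) / t` whose integral over `t > 0` is `-log a`. -/
noncomputable def frullaniKernel (a t : ℝ) : ℝ := t⁻¹ * (Real.exp (-(a * t)) - Real.exp (-t))

lemma frullaniKernel_nonneg {a t : ℝ} (ha : a ≤ 1) (ht : 0 < t) : 0 ≤ frullaniKernel a t := by
  refine mul_nonneg (by positivity) (sub_nonneg.2 (Real.exp_le_exp.2 ?_))
  nlinarith

lemma frullaniKernel_nonpos {a t : ℝ} (ha : 1 ≤ a) (ht : 0 < t) : frullaniKernel a t ≤ 0 := by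
  refine mul_nonpos_of_nonneg_of_nonpos (by positivity) (sub_nonpos.2 (Real.exp_le_exp.2 ?_))
  nlinarith

/-- The graph of `exp` lies above its tangent lines. -/
lemma exp_neg_sub_exp_neg_le (x y : ℝ) :
    Real.exp (-x) - Real.exp (-y) ≤ (y - x) * Real.exp (-x) := by
  have h1 : Real.exp (-y) = Real.exp (-x) * Real.exp (x - y) := by
    rw [← Real.exp_add]; ring_nf
  have h2 := Real.add_one_le_exp (x - y)
  rw [h1]
  nlinarith [Real.exp_pos (-x)]

/-- The tangent bound produces a factor `t` that cancels `t⁻¹`. What remains decays exponentially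
when `a > 0`, which gives integrability on the half line. -/
lemma abs_frullaniKernel_le {a t : ℝ} (ht : 0 < t) :
    |frullaniKernel a t| ≤ |a - 1| * Real.exp (-(min a 1) * t) := by
  have hti := inv_pos.2 ht
  have e : t⁻¹ * t = 1 := inv_mul_cancel₀ ht.ne'
  rcases le_total a 1 with h | h
  · rw [abs_of_nonneg (frullaniKernel_nonneg h ht), abs_of_nonpos (by linarith), min_eq_left h]
    have := exp_neg_sub_exp_neg_le (a * t) t
    calc frullaniKernel a t ≤ t⁻¹ * ((t - a * t) * Real.exp (-(a * t))) :=
          mul_le_mul_of_nonneg_left this hti.le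
      _ = (t⁻¹ * t) * (1 - a) * Real.exp (-(a * t)) := by ring
      _ = _ := by rw [e]; ring_nf
  · rw [abs_of_nonpos (frullaniKernel_nonpos h ht), abs_of_nonneg (by linarith), min_eq_right h]
    have := exp_neg_sub_exp_neg_le t (a * t)
    calc -frullaniKernel a t = t⁻¹ * (Real.exp (-t) - Real.exp (-(a * t))) := by
          unfold frullaniKernel; ring
      _ ≤ t⁻¹ * ((a * t - t) * Real.exp (-t)) := mul_le_mul_of_nonneg_left this hti.le
      _ = (t⁻¹ * t) * (a - 1) * Real.exp (-t) := by ring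
      _ = _ := by rw [e]; ring_nf

lemma measurable_frullaniKernel : Measurable fun p : ℝ × ℝ => frullaniKernel p.1 p.2 := by
  unfold frullaniKernel; fun_prop

lemma integrable_frullaniKernel {a : ℝ} (ha : 0 < a) :
    Integrable (frullaniKernel a) (volume.restrict (Ioi 0)) := by
  have h1 : IntegrableOn (fun t => |a - 1| * Real.exp (-(min a 1) * t)) (Ioi 0) :=
    (exp_neg_integrableOn_Ioi 0 (lt_min ha one_pos)).const_mul _
  refine Integrable.mono' h1
    (measurable_frullaniKernel.comp measurable_prodMk_left).aestronglyMeasurable ?_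
  filter_upwards [ae_restrict_mem measurableSet_Ioi] with t ht
  exact abs_frullaniKernel_le ht

lemma integral_frullaniKernel {a : ℝ} (ha : 0 < a) :
    ∫ t in Ioi 0, frullaniKernel a t = -Real.log a := by
  have h := Frullani.integral_Ioi_eq (f := fun x : ℝ => Real.exp (-x)) (a := a) (b := 1)
    (L := 1) (R := 0) ?_ ha one_pos ?_ ?_ ?_
  · simp only [one_mul, sub_zero, smul_eq_mul, mul_one, one_div, Real.log_inv] at h
    exact h
  · exact (Continuous.locallyIntegrable (by fun_prop)).locallyIntegrableOn _
  · have : Continuous fun x : ℝ => Real.exp (-x) := by fun_prop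
    have := this.tendsto 0
    simp only [neg_zero, Real.exp_zero] at this
    exact this.mono_left nhdsWithin_le_nhds
  · exact Real.tendsto_exp_neg_atTop_nhds_zero
  · have := integrable_frullaniKernel ha
    simp only [one_mul, smul_eq_mul]
    exact this

/-- For fixed `a` the kernel has constant sign in `t`, so its positive and negative parts integrate
to those of `-log a`. This allows Tonelli before any integrability is known. -/
lemma lintegral_frullaniKernel {a : ℝ} (ha : 0 < a) :
    ∫⁻ t in Ioi 0, ENNReal.ofReal (frullaniKernel a t) = ENNReal.ofReal (-Real.log a) := by
  rcases le_total a 1 with h | h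
  · rw [← integral_frullaniKernel ha, ofReal_integral_eq_lintegral_ofReal
      (integrable_frullaniKernel ha)]
    filter_upwards [ae_restrict_mem measurableSet_Ioi] with t ht
    exact frullaniKernel_nonneg h ht
  · rw [ENNReal.ofReal_of_nonpos (neg_nonpos.2 (Real.log_nonneg h)),
      setLIntegral_congr_fun measurableSet_Ioi (g := 0)]
    · simp
    · intro t ht
      simpa using frullaniKernel_nonpos h ht

lemma lintegral_neg_frullaniKernel {a : ℝ} (ha : 0 < a) :
    ∫⁻ t in Ioi 0, ENNReal.ofReal (-frullaniKernel a t) = ENNReal.ofReal (Real.log a) := by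
  rcases le_total a 1 with h | h
  · rw [ENNReal.ofReal_of_nonpos (Real.log_nonpos ha.le h),
      setLIntegral_congr_fun measurableSet_Ioi (g := 0)]
    · simp
    · intro t ht
      simpa using frullaniKernel_nonneg h ht
  · rw [← neg_neg (Real.log a), ← integral_frullaniKernel ha, ← integral_neg]
    refine (ofReal_integral_eq_lintegral_ofReal (integrable_frullaniKernel ha).neg ?_).symm
    filter_upwards [ae_restrict_mem measurableSet_Ioi] with t ht
    simpa using frullaniKernel_nonpos h ht

lemma integral_abs_frullaniKernel {a : ℝ} (ha : 0 < a) :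
    ∫ t in Ioi 0, |frullaniKernel a t| = |Real.log a| := by
  rcases le_total a 1 with h | h
  · rw [abs_of_nonpos (Real.log_nonpos ha.le h), ← integral_frullaniKernel ha]
    refine setIntegral_congr_fun measurableSet_Ioi fun t ht => ?_
    exact abs_of_nonneg (frullaniKernel_nonneg h ht)
  · rw [abs_of_nonneg (Real.log_nonneg h), ← neg_neg (Real.log a), ← integral_frullaniKernel ha,
      ← integral_neg]
    refine setIntegral_congr_fun measurableSet_Ioi fun t ht => ?_
    exact abs_of_nonpos (frullaniKernel_nonpos h ht)

variable {μ ν : Measure ℂ}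

lemma integrable_exp_neg_mul_dist_sq [IsFiniteMeasure μ] [IsFiniteMeasure ν] {t : ℝ}
    (ht : 0 < t) :
    Integrable (fun x : ℂ × ℂ => Real.exp (-(t * ‖x.1 - x.2‖ ^ 2))) (μ.prod ν) := by
  refine Integrable.mono' (integrable_const (1 : ℝ))
    (Continuous.aestronglyMeasurable (by fun_prop)) (ae_of_all _ fun x => ?_)
  rw [Real.norm_of_nonneg (Real.exp_pos _).le, Real.exp_le_one_iff]
  simp only [Left.neg_nonpos_iff]
  positivity

lemma integrable_frullaniKernel_dist [IsFiniteMeasure μ] [IsFiniteMeasure ν] {t : ℝ}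
    (ht : 0 < t) :
    Integrable (fun x : ℂ × ℂ => frullaniKernel (‖x.1 - x.2‖ ^ 2) t) (μ.prod ν) := by
  have := ((integrable_exp_neg_mul_dist_sq (μ := μ) (ν := ν) ht).sub
    (integrable_const (Real.exp (-t)))).const_mul t⁻¹
  refine this.congr (ae_of_all _ fun x => ?_)
  simp [frullaniKernel, mul_comm]

lemma integral_frullaniKernel_dist [IsProbabilityMeasure μ] [IsProbabilityMeasure ν] {t : ℝ}
    (ht : 0 < t) :
    ∫ x, frullaniKernel (‖x.1 - x.2‖ ^ 2) t ∂μ.prod ν =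
      t⁻¹ * (gaussianEnergy t μ ν - Real.exp (-t)) := by
  have := integral_sub (integrable_exp_neg_mul_dist_sq (μ := μ) (ν := ν) ht)
    (integrable_const (Real.exp (-t)))
  simp only [integral_const, probReal_univ, smul_eq_mul, one_mul] at this
  rw [gaussianEnergy, ← this, ← integral_const_mul]
  simp [frullaniKernel, mul_comm]

lemma log_norm_sq (z : ℂ) : Real.log (‖z‖ ^ 2) = 2 * Real.log ‖z‖ := by
  rw [Real.log_pow]; norm_num

/-- By constancy of sign, the `t`-integral of the absolute value is exactly `2 |log |z - w||` off
the diagonal. -/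
lemma LogIntegrable.integrable_frullaniKernel_prod [IsFiniteMeasure μ] [IsFiniteMeasure ν]
    (h : LogIntegrable μ ν) :
    Integrable (fun p : ℝ × (ℂ × ℂ) => frullaniKernel (‖p.2.1 - p.2.2‖ ^ 2) p.1)
      ((volume.restrict (Ioi 0)).prod (μ.prod ν)) := by
  have hm : Measurable fun p : ℝ × (ℂ × ℂ) => frullaniKernel (‖p.2.1 - p.2.2‖ ^ 2) p.1 := by
    unfold frullaniKernel; fun_prop
  rw [integrable_prod_iff' hm.aestronglyMeasurable]
  refine ⟨?_, ?_⟩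
  · filter_upwards [h.ne] with x hx
    have : 0 < ‖x.1 - x.2‖ := norm_pos_iff.2 (sub_ne_zero.2 hx)
    exact integrable_frullaniKernel (by positivity)
  · refine (h.integrable.abs.const_mul 2).congr ?_
    filter_upwards [h.ne] with x hx
    have : 0 < ‖x.1 - x.2‖ := norm_pos_iff.2 (sub_ne_zero.2 hx)
    simp only [Real.norm_eq_abs]
    rw [integral_abs_frullaniKernel (by positivity), log_norm_sq, abs_mul]
    simp

lemma LogIntegrable.integral_gaussianEnergy [IsProbabilityMeasure μ] [IsProbabilityMeasure ν]
    (h : LogIntegrable μ ν) :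
    Integrable (fun t => t⁻¹ * (gaussianEnergy t μ ν - Real.exp (-t)))
      (volume.restrict (Ioi 0)) ∧
    ∫ t in Ioi 0, t⁻¹ * (gaussianEnergy t μ ν - Real.exp (-t)) = -2 * realEnergy μ ν := by
  have hi := h.integrable_frullaniKernel_prod
  have e : ∀ᵐ t ∂(volume.restrict (Ioi (0 : ℝ))), ∫ x, frullaniKernel (‖x.1 - x.2‖ ^ 2) t ∂μ.prod ν
      = t⁻¹ * (gaussianEnergy t μ ν - Real.exp (-t)) := by
    filter_upwards [ae_restrict_mem measurableSet_Ioi] with t ht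
    exact integral_frullaniKernel_dist ht
  refine ⟨hi.integral_prod_left.congr e, ?_⟩
  rw [← integral_congr_ae e, integral_integral_swap hi, realEnergy, ← integral_const_mul]
  refine integral_congr_ae ?_
  filter_upwards [h.ne] with x hx
  have : 0 < ‖x.1 - x.2‖ := norm_pos_iff.2 (sub_ne_zero.2 hx)
  rw [integral_frullaniKernel (by positivity), log_norm_sq]
  ring

/-- An atom would give the diagonal positive product measure. -/
lemma LogIntegrable.noAtoms [SFinite μ] (h : LogIntegrable μ μ) (z : ℂ) : μ {z} = 0 := by
  have h1 : (μ.prod μ) ({z} ×ˢ {z}) = 0 := by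
    refine measure_mono_null ?_ (ae_iff.1 h.ne)
    rintro ⟨a, b⟩ ⟨ha, hb⟩
    simp_all
  rw [Measure.prod_prod] at h1
  exact mul_self_eq_zero.1 h1

lemma lintegral_ofReal_le {X : Type*} [MeasurableSpace X] {m : Measure X} {g : X → ℝ}
    (hg : Integrable g m) :
    ∫⁻ x, ENNReal.ofReal (g x) ∂m ≤
      ENNReal.ofReal (∫ x, g x ∂m) + ∫⁻ x, ENNReal.ofReal (-g x) ∂m := by
  have h2 : ∫⁻ x, ENNReal.ofReal (-g x) ∂m ≠ ⊤ := by
    simpa using hg.neg.lintegral_lt_top.ne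
  rw [← ENNReal.ofReal_toReal hg.lintegral_lt_top.ne]
  conv_rhs => rw [← ENNReal.ofReal_toReal h2]
  refine le_trans (ENNReal.ofReal_le_ofReal ?_) ENNReal.ofReal_add_le
  rw [integral_eq_lintegral_pos_part_sub_lintegral_neg_part hg]
  linarith

/-- The mutual energy might a priori be `-∞`, so the inequality between energies cannot be
integrated directly. It is applied for each `t`, where everything is finite: the positive part of
the Frullani kernel integrates to at most its mean plus its negative part. The mean is bounded by
the average of the two self-terms, integrable in `t`; the negative part sums to the positive part of
`log |z - w|²`, finite by the logarithmic moments. -/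
lemma LogIntegrable.cross [IsProbabilityMeasure μ] [IsProbabilityMeasure ν]
    (hμ : LogIntegrable μ μ) (hν : LogIntegrable ν ν) : LogIntegrable μ ν := by
  have hne : ∀ᵐ x ∂μ.prod ν, x.1 ≠ x.2 := by
    refine (Measure.ae_prod_iff_ae_ae ?_).2 (ae_of_all _ fun z => ?_)
    · exact (measurableSet_eq_fun measurable_fst measurable_snd).compl
    · refine measure_mono_null ?_ (hν.noAtoms z)
      -- The fibre of the diagonal over `z` is a single point, which `ν` does not charge.
      intro w hw
      simp only [mem_compl_iff, mem_ofPred_eq, not_not] at hw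
      exact hw.symm
  have hpos : ∀ᵐ x ∂μ.prod ν, 0 < ‖x.1 - x.2‖ ^ 2 := by
    filter_upwards [hne] with x hx
    have := norm_pos_iff.2 (sub_ne_zero.2 hx)
    positivity
  have hm : Measurable fun p : ℝ × (ℂ × ℂ) => frullaniKernel (‖p.2.1 - p.2.2‖ ^ 2) p.1 := by
    unfold frullaniKernel; fun_prop
  have hlogpos : ∫⁻ x, ENNReal.ofReal (Real.log (‖x.1 - x.2‖ ^ 2)) ∂μ.prod ν ≠ ⊤ := by
    have hi := ((hμ.hasLogMoment.integrable_fst (ν := ν)).add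
      (hν.hasLogMoment.integrable_snd (μ := μ))).const_mul 2
    refine ne_top_of_le_ne_top hi.lintegral_lt_top.ne (lintegral_mono fun x => ?_)
    refine ENNReal.ofReal_le_ofReal ?_
    rw [log_norm_sq]
    have := log_norm_sub_le x.1 x.2
    simpa using this
  have hneg : ∫⁻ t in Ioi (0 : ℝ), ∫⁻ x, ENNReal.ofReal (-frullaniKernel (‖x.1 - x.2‖ ^ 2) t)
      ∂μ.prod ν = ∫⁻ x, ENNReal.ofReal (Real.log (‖x.1 - x.2‖ ^ 2)) ∂μ.prod ν := by
    rw [lintegral_lintegral_swap hm.neg.ennreal_ofReal.aemeasurable]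
    refine lintegral_congr_ae ?_
    filter_upwards [hpos] with x hx
    exact lintegral_neg_frullaniKernel hx
  have hlogneg : ∫⁻ x, ENNReal.ofReal (-Real.log (‖x.1 - x.2‖ ^ 2)) ∂μ.prod ν ≠ ⊤ := by
    have e : ∫⁻ x, ENNReal.ofReal (-Real.log (‖x.1 - x.2‖ ^ 2)) ∂μ.prod ν =
        ∫⁻ t in Ioi (0 : ℝ), ∫⁻ x, ENNReal.ofReal (frullaniKernel (‖x.1 - x.2‖ ^ 2) t)
          ∂μ.prod ν := by
      rw [lintegral_lintegral_swap hm.ennreal_ofReal.aemeasurable]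
      refine lintegral_congr_ae ?_
      filter_upwards [hpos] with x hx
      exact (lintegral_frullaniKernel hx).symm
    have hi := (hμ.integral_gaussianEnergy.1.add hν.integral_gaussianEnergy.1).const_mul (1 / 2)
    have hle : ∫⁻ t in Ioi (0 : ℝ), ∫⁻ x, ENNReal.ofReal (frullaniKernel (‖x.1 - x.2‖ ^ 2) t)
          ∂μ.prod ν ≤ ∫⁻ t in Ioi (0 : ℝ),
        (ENNReal.ofReal ((1 / 2) * (t⁻¹ * (gaussianEnergy t μ μ - Real.exp (-t)) +
          t⁻¹ * (gaussianEnergy t ν ν - Real.exp (-t)))) +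
        ∫⁻ x, ENNReal.ofReal (-frullaniKernel (‖x.1 - x.2‖ ^ 2) t) ∂μ.prod ν) := by
      refine setLIntegral_mono' measurableSet_Ioi fun t ht => ?_
      refine (lintegral_ofReal_le (integrable_frullaniKernel_dist ht)).trans ?_
      gcongr
      rw [integral_frullaniKernel_dist ht]
      have := two_mul_gaussianEnergy_le (μ := μ) (ν := ν) ht
      have ht' : 0 < t⁻¹ := inv_pos.2 ht
      nlinarith
    rw [e]
    refine ne_top_of_le_ne_top ?_ hle
    rw [lintegral_add_right _ (Measurable.lintegral_prod_right' (f := fun p : ℝ × (ℂ × ℂ) =>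
      ENNReal.ofReal (-frullaniKernel (‖p.2.1 - p.2.2‖ ^ 2) p.1)) hm.neg.ennreal_ofReal), hneg]
    exact ENNReal.add_ne_top.2 ⟨hi.lintegral_lt_top.ne, hlogpos⟩
  refine ⟨hne, ?_⟩
  have hc : ∀ r : ℝ, (r : EReal).toENNReal = ENNReal.ofReal r := fun r => by
    rw [EReal.toENNReal_of_ne_top (EReal.coe_ne_top _), EReal.toReal_coe]
  have := (ae_ne_bot_and_integrable_toReal (μ := μ.prod ν)
    (f := fun x : ℂ × ℂ => ((Real.log (‖x.1 - x.2‖ ^ 2) : ℝ) : EReal))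
    (Measurable.coe_real_ereal (by fun_prop)) (by simpa only [hc] using hlogpos)
    (by simpa only [← EReal.coe_neg, hc] using hlogneg)).2
  refine (this.const_mul (1 / 2)).congr (ae_of_all _ fun x => ?_)
  simp only [EReal.toReal_coe, log_norm_sq]
  ring

/-- In this combination the terms `e^{-t}` cancel, since `1 + 1 - 2 = 0`. -/
lemma integral_gaussianEnergy_defect [IsProbabilityMeasure μ] [IsProbabilityMeasure ν]
    (hμ : LogIntegrable μ μ) (hν : LogIntegrable ν ν) :
    Integrable (fun t => t⁻¹ * (gaussianEnergy t μ μ + gaussianEnergy t ν ν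
      - 2 * gaussianEnergy t μ ν)) (volume.restrict (Ioi 0)) ∧
    ∫ t in Ioi 0, t⁻¹ * (gaussianEnergy t μ μ + gaussianEnergy t ν ν - 2 * gaussianEnergy t μ ν) =
      2 * (2 * realEnergy μ ν - realEnergy μ μ - realEnergy ν ν) := by
  obtain ⟨i1, e1⟩ := hμ.integral_gaussianEnergy
  obtain ⟨i2, e2⟩ := hν.integral_gaussianEnergy
  obtain ⟨i3, e3⟩ := (hμ.cross hν).integral_gaussianEnergy
  have e : ∀ t : ℝ, t⁻¹ * (gaussianEnergy t μ μ + gaussianEnergy t ν ν - 2 * gaussianEnergy t μ ν)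
      = t⁻¹ * (gaussianEnergy t μ μ - Real.exp (-t)) + t⁻¹ * (gaussianEnergy t ν ν - Real.exp (-t))
        - 2 * (t⁻¹ * (gaussianEnergy t μ ν - Real.exp (-t))) := fun t => by ring
  simp_rw [e]
  refine ⟨(i1.add i2).sub (i3.const_mul 2), ?_⟩
  rw [integral_sub ?_ (i3.const_mul 2), integral_add i1 i2, integral_const_mul, e1, e2, e3]
  · ring
  · exact i1.add i2

theorem realEnergy_add_le_two_mul [IsProbabilityMeasure μ] [IsProbabilityMeasure ν]
    (hμ : LogIntegrable μ μ) (hν : LogIntegrable ν ν) :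
    realEnergy μ μ + realEnergy ν ν ≤ 2 * realEnergy μ ν := by
  obtain ⟨-, h⟩ := integral_gaussianEnergy_defect hμ hν
  have : 0 ≤ ∫ t in Ioi 0, t⁻¹ * (gaussianEnergy t μ μ + gaussianEnergy t ν ν
      - 2 * gaussianEnergy t μ ν) := by
    refine setIntegral_nonneg measurableSet_Ioi fun t ht => ?_
    have h1 := two_mul_gaussianEnergy_le (μ := μ) (ν := ν) ht
    exact mul_nonneg (inv_pos.2 ht).le (by linarith)
  linarith

/-- Equality makes a nonnegative function of `t` integrate to zero. A single `t > 0` where it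
vanishes is enough for the Gaussian equality case. -/
theorem eq_of_two_mul_realEnergy_le [IsProbabilityMeasure μ] [IsProbabilityMeasure ν]
    (hμ : LogIntegrable μ μ) (hν : LogIntegrable ν ν)
    (hle : 2 * realEnergy μ ν ≤ realEnergy μ μ + realEnergy ν ν) : μ = ν := by
  obtain ⟨hi, h⟩ := integral_gaussianEnergy_defect hμ hν
  have hn : 0 ≤ᵐ[volume.restrict (Ioi (0 : ℝ))] fun t => t⁻¹ * (gaussianEnergy t μ μ +
      gaussianEnergy t ν ν - 2 * gaussianEnergy t μ ν) := by
    filter_upwards [ae_restrict_mem measurableSet_Ioi] with t ht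
    have h1 := two_mul_gaussianEnergy_le (μ := μ) (ν := ν) ht
    exact mul_nonneg (inv_pos.2 ht).le (by linarith)
  have h0 := realEnergy_add_le_two_mul hμ hν
  have hz : ∫ t in Ioi 0, t⁻¹ * (gaussianEnergy t μ μ + gaussianEnergy t ν ν
      - 2 * gaussianEnergy t μ ν) = 0 := by rw [h]; linarith
  rw [integral_eq_zero_iff_of_nonneg_ae hn hi] at hz
  have : NeZero (volume.restrict (Ioi (0 : ℝ))) := ⟨by simp⟩
  obtain ⟨t, ht1, ht2⟩ := (hz.and (ae_restrict_mem measurableSet_Ioi)).exists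
  refine eq_of_two_mul_gaussianEnergy_eq (t := t) ht2 ?_
  have ht3 : t⁻¹ ≠ 0 := inv_ne_zero (ne_of_gt ht2)
  simp only [Pi.zero_apply, mul_eq_zero, ht3, false_or] at ht1
  linarith

end PositiveDefinite

end LogEnergy
namespace LogEnergy

/-! ### Potentials of circles and discs -/

section Radial

variable {μ ν : Measure ℂ}

lemma PotentialFinite.add {z : ℂ} (h1 : PotentialFinite μ z) (h2 : PotentialFinite ν z) :
    PotentialFinite (μ + ν) z :=
  ⟨ae_add_measure_iff.2 ⟨h1.1, h2.1⟩, h1.2.add_measure h2.2⟩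

lemma PotentialFinite.realPotential_add {z : ℂ} (h1 : PotentialFinite μ z)
    (h2 : PotentialFinite ν z) :
    realPotential (μ + ν) z = realPotential μ z + realPotential ν z :=
  integral_add_measure h1.2 h2.2

lemma PotentialFinite.smul {z : ℂ} (h : PotentialFinite μ z) {c : ℝ≥0∞} (hc : c ≠ ⊤) :
    PotentialFinite (c • μ) z :=
  ⟨Measure.ae_smul_measure h.1 c, h.2.smul_measure hc⟩

lemma PotentialFinite.mono {z : ℂ} (h : PotentialFinite μ z) (hle : ν ≤ μ) :
    PotentialFinite ν z :=
  ⟨ae_mono hle h.1, h.2.mono_measure hle⟩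

lemma realPotential_smul (c : ℝ≥0∞) (z : ℂ) :
    realPotential (c • μ) z = c.toReal * realPotential μ z :=
  integral_smul_measure _ _

/-- Uses `|x| = 2 x⁺ - x` and the upper bound for the positive part. A lower bound for the potential
thereby bounds the integral of `|log |z - w||`. -/
lemma abs_log_norm_sub_le (z w : ℂ) :
    |Real.log ‖z - w‖| ≤
      2 * (Real.log (1 + ‖z‖) + Real.log (1 + ‖w‖)) - Real.log ‖z - w‖ := by
  have h := log_norm_sub_le z w
  have h1 := log_one_add_norm_nonneg z
  have h2 := log_one_add_norm_nonneg w
  rcases abs_cases (Real.log ‖z - w‖) with ⟨h3, -⟩ | ⟨h3, -⟩ <;> rw [h3] <;> linarith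

/-- A measure with everywhere finite potential bounded below is log-integrable against every
measure with a logarithmic moment. -/
lemma logIntegrable_of_potential [IsFiniteMeasure μ] [IsFiniteMeasure ν] (hμ : HasLogMoment μ)
    (hν : HasLogMoment ν) (h : ∀ z, PotentialFinite ν z) {C : ℝ}
    (hC : ∀ z, C ≤ realPotential ν z) : LogIntegrable μ ν := by
  refine ⟨?_, ?_⟩
  · refine (Measure.ae_prod_iff_ae_ae ?_).2 (ae_of_all _ fun z => (h z).1)
    exact (measurableSet_eq_fun measurable_fst measurable_snd).compl
  · rw [integrable_prod_iff measurable_log_norm_sub.aestronglyMeasurable]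
    refine ⟨ae_of_all _ fun z => (h z).2, ?_⟩
    have hb : Integrable (fun z : ℂ => ν.real univ * (2 * Real.log (1 + ‖z‖)) +
        2 * ∫ w, Real.log (1 + ‖w‖) ∂ν - C) μ :=
      (((hμ.const_mul 2).const_mul _).add (integrable_const _)).sub (integrable_const _)
    refine Integrable.mono' hb (measurable_log_norm_sub.norm.aestronglyMeasurable.integral_prod_right')
      (ae_of_all _ fun z => ?_)
    rw [Real.norm_of_nonneg (integral_nonneg fun w => norm_nonneg _)]
    have i1 : Integrable (fun w : ℂ => 2 * Real.log (1 + ‖z‖) + 2 * Real.log (1 + ‖w‖)) ν :=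
      (integrable_const _).add (Integrable.const_mul hν 2)
    have h1 : ∫ w, ‖Real.log ‖z - w‖‖ ∂ν ≤
        ∫ w, (2 * Real.log (1 + ‖z‖) + 2 * Real.log (1 + ‖w‖) - Real.log ‖z - w‖) ∂ν := by
      refine integral_mono (h z).2.norm (i1.sub (h z).2) fun w => ?_
      have := abs_log_norm_sub_le z w
      simp only [Real.norm_eq_abs]
      linarith
    rw [integral_sub i1 (h z).2, integral_add (integrable_const _) (Integrable.const_mul hν 2),
      integral_const, integral_const_mul, smul_eq_mul] at h1
    have := hC z
    unfold realPotential at this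
    linarith

/-- Normalized arc length on the circle of radius `t` about the origin. -/
noncomputable def circleMeasure (t : ℝ) : Measure ℂ :=
  ENNReal.ofReal (1 / (2 * Real.pi)) •
    (volume.restrict (Ioc 0 (2 * Real.pi))).map (circleMap 0 t)

lemma circleUniform_eq : circleUniform = circleMeasure 1 := rfl

lemma measurable_circleMap (t : ℝ) : Measurable (circleMap 0 t) :=
  (continuous_circleMap 0 t).measurable

instance (t : ℝ) : IsProbabilityMeasure (circleMeasure t) := by
  refine ⟨?_⟩
  rw [circleMeasure, Measure.smul_apply, Measure.map_apply (measurable_circleMap t) .univ,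
    preimage_univ, Measure.restrict_apply_univ, Real.volume_Ioc, smul_eq_mul,
    ← ENNReal.ofReal_mul (by positivity)]
  have := Real.pi_pos
  rw [show 1 / (2 * Real.pi) * (2 * Real.pi - 0) = 1 by field_simp; ring, ENNReal.ofReal_one]

lemma ae_circleMeasure_iff {t : ℝ} {p : ℂ → Prop} (hp : MeasurableSet {z | p z}) :
    (∀ᵐ z ∂circleMeasure t, p z) ↔
      ∀ᵐ θ ∂volume.restrict (Ioc 0 (2 * Real.pi)), p (circleMap 0 t θ) := by
  rw [circleMeasure, Measure.ae_ennreal_smul_measure_iff (by simp [Real.pi_pos]),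
    ae_map_iff (measurable_circleMap t).aemeasurable hp]

lemma norm_eq_ae_circleMeasure {t : ℝ} (ht : 0 ≤ t) : ∀ᵐ z ∂circleMeasure t, ‖z‖ = t := by
  rw [ae_circleMeasure_iff (measurableSet_eq_fun measurable_norm measurable_const)]
  exact ae_of_all _ fun θ => by simp [abs_of_nonneg ht]

lemma ne_ae_circleMeasure {t : ℝ} (ht : t ≠ 0) (z : ℂ) : ∀ᵐ w ∂circleMeasure t, z ≠ w := by
  rw [ae_circleMeasure_iff (p := fun w => z ≠ w)
    (measurableSet_eq_fun measurable_const measurable_id).compl]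
  refine ae_restrict_of_ae ?_
  have : (circleMap 0 t ⁻¹' {z}).Countable := (countable_singleton z).preimage_circleMap 0 ht
  refine (this.ae_notMem volume).mono fun θ hθ h => hθ ?_
  simp [h]

lemma integrable_circleMeasure {t : ℝ} {F : ℂ → ℝ} (hF : Measurable F)
    (h : CircleIntegrable F 0 t) : Integrable F (circleMeasure t) := by
  refine Integrable.smul_measure ?_ ENNReal.ofReal_ne_top
  rw [integrable_map_measure hF.aestronglyMeasurable (measurable_circleMap t).aemeasurable]
  exact (intervalIntegrable_iff_integrableOn_Ioc_of_le (by positivity)).1 h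

lemma integral_circleMeasure {t : ℝ} {F : ℂ → ℝ} (hF : Measurable F) :
    ∫ z, F z ∂circleMeasure t = Real.circleAverage F 0 t := by
  rw [circleMeasure, integral_smul_measure,
    integral_map (measurable_circleMap t).aemeasurable hF.aestronglyMeasurable,
    ENNReal.toReal_ofReal (by positivity), Real.circleAverage,
    intervalIntegral.integral_of_le (by positivity), one_div]

lemma potentialFinite_circleMeasure {t : ℝ} (ht : t ≠ 0) (z : ℂ) :
    PotentialFinite (circleMeasure t) z := by
  refine ⟨ne_ae_circleMeasure ht z, ?_⟩
  refine integrable_circleMeasure (by fun_prop) ?_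
  simp_rw [norm_sub_rev z]
  exact circleIntegrable_log_norm_sub_const t

/-- Jensen's formula for the mean of `log |w - z|` over a circle. The radius `t = 0`, a point mass
at the origin, is included because the case `p = 0` compares with it. -/
lemma realPotential_circleMeasure {t : ℝ} (ht : 0 ≤ t) (z : ℂ) :
    realPotential (circleMeasure t) z = Real.log (max ‖z‖ t) := by
  unfold realPotential
  rw [integral_circleMeasure (by fun_prop)]
  rcases ht.eq_or_lt with rfl | ht
  · simp
  · simp_rw [norm_sub_rev z]
    rw [circleAverage_log_norm_sub_const_eq_log_radius_add_posLog ht.ne',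
      Real.posLog_eq_log_max_one (by positivity), ← Real.log_mul ht.ne' (by positivity),
      mul_max_of_nonneg _ _ ht.le, zero_sub, norm_neg, mul_one, mul_inv_cancel_left₀ ht.ne',
      max_comm]

lemma hasLogMoment_of_ae_bounded [IsFiniteMeasure μ] {R : ℝ} (h : ∀ᵐ z ∂μ, ‖z‖ ≤ R) :
    HasLogMoment μ := by
  refine Integrable.mono' (integrable_const (Real.log (1 + R)))
    measurable_log_one_add_norm.aestronglyMeasurable ?_
  filter_upwards [h] with z hz
  rw [Real.norm_of_nonneg (log_one_add_norm_nonneg z)]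
  exact Real.log_le_log (by linarith [norm_nonneg z]) (by linarith)

lemma hasLogMoment_circleMeasure {t : ℝ} (ht : 0 ≤ t) : HasLogMoment (circleMeasure t) :=
  hasLogMoment_of_ae_bounded ((norm_eq_ae_circleMeasure ht).mono fun _ h => h.le)

lemma HasLogMoment.logIntegrable_circleMeasure [IsFiniteMeasure μ] (hμ : HasLogMoment μ) {t : ℝ}
    (ht : 0 < t) : LogIntegrable μ (circleMeasure t) := by
  refine logIntegrable_of_potential hμ (hasLogMoment_circleMeasure ht.le)
    (potentialFinite_circleMeasure ht.ne') (C := Real.log t) fun z => ?_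
  rw [realPotential_circleMeasure ht.le]
  exact Real.log_le_log ht (le_max_right _ _)

/-- Area measure divided by `π` on the disc of radius `√s`; its total mass is `s`. -/
noncomputable def discMeasure (s : ℝ) : Measure ℂ :=
  ENNReal.ofReal (1 / Real.pi) • volume.restrict (Metric.closedBall 0 √s)

lemma discMeasure_univ {s : ℝ} (hs : 0 ≤ s) : discMeasure s univ = ENNReal.ofReal s := by
  rw [discMeasure, Measure.smul_apply, Measure.restrict_apply_univ, Complex.volume_closedBall,
    ← ENNReal.ofReal_pow (Real.sqrt_nonneg s), Real.sq_sqrt hs, smul_eq_mul,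
    ← ENNReal.ofReal_coe_nnreal, ← ENNReal.ofReal_mul hs, ← ENNReal.ofReal_mul (by positivity)]
  congr 1
  have := Real.pi_pos
  rw [NNReal.coe_real_pi]
  field_simp

instance (s : ℝ) : IsFiniteMeasure (discMeasure s) := by
  rcases le_total 0 s with h | h
  · exact ⟨by rw [discMeasure_univ h]; exact ENNReal.ofReal_lt_top⟩
  · refine ⟨?_⟩
    rw [discMeasure, Real.sqrt_eq_zero_of_nonpos h]
    simp

lemma norm_le_ae_discMeasure (s : ℝ) : ∀ᵐ z ∂discMeasure s, ‖z‖ ≤ √s := by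
  refine Measure.ae_smul_measure ?_ _
  filter_upwards [ae_restrict_mem Metric.isClosed_closedBall.measurableSet] with z hz
  simpa using hz

lemma hasLogMoment_discMeasure (s : ℝ) : HasLogMoment (discMeasure s) :=
  hasLogMoment_of_ae_bounded (norm_le_ae_discMeasure s)

lemma integrableOn_log_norm (R : ℝ) : IntegrableOn (fun w : ℂ => Real.log ‖w‖)
    (Metric.ball 0 R) := by
  rw [integrableOn_fun_norm_addHaar volume (f := Real.log), Complex.finrank_real_complex]
  have : IntegrableOn (fun y : ℝ => y * Real.log y) (Icc 0 R) :=
    Real.continuous_mul_log.continuousOn.integrableOn_Icc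
  simpa using this.mono_set Ioo_subset_Icc_self

/-- The logarithm is locally integrable in the plane by polar coordinates, and `w ↦ z - w` maps the
disc into a ball about the origin. -/
lemma potentialFinite_discMeasure (s : ℝ) (z : ℂ) : PotentialFinite (discMeasure s) z := by
  refine ⟨Measure.ae_smul_measure (ae_restrict_of_ae ?_) _,
    Integrable.smul_measure ?_ ENNReal.ofReal_ne_top⟩
  · exact (Measure.ae_ne volume z).mono fun w hw => hw.symm
  · have h1 := integrableOn_log_norm (√s + ‖z‖ + 1)
    have h2 : MeasurePreserving (fun w : ℂ => z - w) volume volume :=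
      Measure.measurePreserving_sub_left volume z
    have h3 := (h2.restrict_preimage (s := Metric.ball 0 (√s + ‖z‖ + 1))
      Metric.isOpen_ball.measurableSet).integrable_comp_of_integrable h1
    refine IntegrableOn.mono_set h3 fun w hw => ?_
    simp only [Metric.mem_closedBall, dist_zero_right] at hw
    simp only [mem_preimage, Metric.mem_ball, dist_zero_right]
    linarith [norm_sub_le z w]

lemma integral_norm_discMeasure {s : ℝ} (g : ℝ → ℝ) :
    ∫ z, g ‖z‖ ∂discMeasure s = 2 * ∫ y in (0 : ℝ)..√s, y * g y := by
  have hi : ∀ z : ℂ, (Metric.closedBall (0 : ℂ) √s).indicator (fun z => g ‖z‖) z =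
      (Iic √s).indicator g ‖z‖ := by
    intro z
    simp [indicator]
  rw [discMeasure, integral_smul_measure, ← integral_indicator
    Metric.isClosed_closedBall.measurableSet]
  simp_rw [hi]
  rw [integral_fun_norm_addHaar, Complex.finrank_real_complex, measureReal_def, Complex.volume_ball,
    intervalIntegral.integral_of_le (Real.sqrt_nonneg s), ENNReal.toReal_ofReal (by positivity)]
  have h2 : ∀ y : ℝ, y ^ (2 - 1) • (Iic √s).indicator g y =
      (Iic √s).indicator (fun y => y * g y) y := by
    intro y
    by_cases h : y ≤ √s <;> simp [h]
  simp_rw [h2]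
  rw [setIntegral_indicator measurableSet_Iic, Ioi_inter_Iic]
  simp only [ENNReal.ofReal_one, one_pow, one_mul, ENNReal.coe_toReal, NNReal.coe_real_pi,
    smul_eq_mul, nsmul_eq_mul]
  have := Real.pi_pos
  field_simp
  push_cast
  ring

lemma integral_norm_sq_discMeasure {s : ℝ} (hs : 0 ≤ s) :
    ∫ z, ‖z‖ ^ 2 ∂discMeasure s = s ^ 2 / 2 := by
  rw [integral_norm_discMeasure (fun y => y ^ 2)]
  have : ∀ y : ℝ, y * y ^ 2 = y ^ 3 := fun y => by ring
  simp_rw [this]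
  rw [integral_pow]
  have h4 : √s ^ 4 = s ^ 2 := by
    rw [show √s ^ 4 = (√s ^ 2) ^ 2 by ring, Real.sq_sqrt hs]
  norm_num [h4]
  ring

lemma measurePreserving_rotation_discMeasure (s : ℝ) (c : Circle) :
    MeasurePreserving (rotation c) (discMeasure s) (discMeasure s) := by
  have h := (rotation c).measurePreserving.restrict_preimage
    (Metric.isClosed_closedBall (x := (0 : ℂ)) (ε := √s)).measurableSet
  have e : rotation c ⁻¹' Metric.closedBall 0 √s = Metric.closedBall 0 √s := by
    ext z
    simp only [mem_preimage, mem_closedBall_zero_iff, LinearIsometryEquiv.norm_map]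
  rw [e] at h
  refine ⟨h.measurable, ?_⟩
  rw [discMeasure, Measure.map_smul, h.map_eq]

lemma realPotential_discMeasure_rotation (s : ℝ) (c : Circle) (z : ℂ) :
    realPotential (discMeasure s) (rotation c z) = realPotential (discMeasure s) z := by
  unfold realPotential
  rw [← (measurePreserving_rotation_discMeasure s c).integral_comp
    (rotation c).toHomeomorph.measurableEmbedding]
  congr 1
  ext w
  rw [← map_sub, LinearIsometryEquiv.norm_map]

/-- By rotation invariance the potential at `z` equals its mean over the circle through `z`.
Exchanging the integrals replaces the kernel by the circle's own potential, `log (max |w| |z|)`. -/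
lemma realPotential_discMeasure_eq_integral (s : ℝ) (z : ℂ) :
    realPotential (discMeasure s) z = ∫ w, Real.log (max ‖w‖ ‖z‖) ∂discMeasure s := by
  rcases eq_or_ne z 0 with rfl | hz
  · simp [realPotential]
  have hz' := norm_pos_iff.2 hz
  have hL := (hasLogMoment_discMeasure s).logIntegrable_circleMeasure hz'
  have h1 : ∫ w, realPotential (discMeasure s) w ∂circleMeasure ‖z‖ =
      realPotential (discMeasure s) z := by
    have : ∀ᵐ w ∂circleMeasure ‖z‖, realPotential (discMeasure s) w =
        realPotential (discMeasure s) z := by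
      filter_upwards [norm_eq_ae_circleMeasure (norm_nonneg z)] with w hw
      have hc : ‖w / z‖ = 1 := by rw [norm_div, hw, div_self hz'.ne']
      obtain ⟨c, hc⟩ : ∃ c : Circle, (c : ℂ) = w / z :=
        ⟨⟨w / z, mem_sphere_zero_iff_norm.2 hc⟩, rfl⟩
      have : rotation c z = w := by
        rw [rotation_apply, hc]
        exact div_mul_cancel₀ w hz
      rw [← this, realPotential_discMeasure_rotation]
    rw [integral_congr_ae this]
    simp
  rw [← h1, hL.symm.integral_potential, realEnergy_comm, ← hL.integral_potential]
  simp_rw [realPotential_circleMeasure (norm_nonneg z)]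

/-- The potential of `discMeasure s` as a function of `σ = |z|²`. -/
noncomputable def discPotential (s σ : ℝ) : ℝ :=
  if σ ≤ s then (s * Real.log s - s + σ) / 2 else s * Real.log σ / 2

lemma integral_mul_log_zero {a b : ℝ} (ha : 0 ≤ a) (hab : a ≤ b) :
    ∫ y in a..b, y * Real.log y =
      (b ^ 2 * Real.log b / 2 - b ^ 2 / 4) - (a ^ 2 * Real.log a / 2 - a ^ 2 / 4) := by
  have hc := Real.continuous_mul_log
  refine intervalIntegral.integral_eq_sub_of_hasDerivAt_of_le
    (f := fun y => y ^ 2 * Real.log y / 2 - y ^ 2 / 4) hab ?_ ?_ (hc.intervalIntegrable a b)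
  -- The primitive is rewritten with `y * log y`, which is continuous at `0`.
  · have : Continuous fun y : ℝ => y * (y * Real.log y) / 2 - y ^ 2 / 4 := by fun_prop
    refine this.continuousOn.congr fun y _ => ?_
    ring
  · intro y hy
    have hy0 : y ≠ 0 := (ha.trans_lt hy.1).ne'
    have h := (((hasDerivAt_pow 2 y).mul (Real.hasDerivAt_log hy0)).div_const 2).sub
      ((hasDerivAt_pow 2 y).div_const 4)
    refine h.congr_deriv ?_
    norm_num
    field_simp
    ring

lemma integral_mul_log_max {r R : ℝ} (hr : 0 ≤ r) (hR : 0 ≤ R) :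
    ∫ y in (0 : ℝ)..R, y * Real.log (max y r) =
      if r ≤ R then R ^ 2 * Real.log R / 2 - R ^ 2 / 4 + r ^ 2 / 4 else R ^ 2 * Real.log r / 2 := by
  have hconst : ∀ S, 0 ≤ S → S ≤ r →
      ∫ y in (0 : ℝ)..S, y * Real.log (max y r) = S ^ 2 * Real.log r / 2 := by
    intro S hS hSr
    have : ∫ y in (0 : ℝ)..S, y * Real.log (max y r) = ∫ y in (0 : ℝ)..S, y * Real.log r := by
      refine intervalIntegral.integral_congr fun y hy => ?_
      rw [uIcc_of_le hS] at hy
      rw [max_eq_right (hy.2.trans hSr)]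
    rw [this, intervalIntegral.integral_mul_const, integral_id]
    ring
  split_ifs with h
  · have e : EqOn (fun y : ℝ => y * Real.log (max y r)) (fun y => y * Real.log y) (uIcc r R) := by
      intro y hy
      rw [uIcc_of_le h] at hy
      simp only
      rw [max_eq_left hy.1]
    have e' : EqOn (fun y : ℝ => y * Real.log (max y r)) (fun y => y * Real.log r)
        (uIcc 0 r) := by
      intro y hy
      rw [uIcc_of_le hr] at hy
      simp only
      rw [max_eq_right hy.2]
    have i1 : IntervalIntegrable (fun y : ℝ => y * Real.log (max y r)) volume 0 r :=
      IntervalIntegrable.congr (fun y hy => (e' (uIoc_subset_uIcc hy)).symm)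
        ((continuous_id.mul continuous_const).intervalIntegrable _ _)
    have i2 : IntervalIntegrable (fun y : ℝ => y * Real.log (max y r)) volume r R :=
      IntervalIntegrable.congr (fun y hy => (e (uIoc_subset_uIcc hy)).symm)
        (Real.continuous_mul_log.intervalIntegrable _ _)
    rw [← intervalIntegral.integral_add_adjacent_intervals i1 i2, hconst r hr le_rfl,
      intervalIntegral.integral_congr e, integral_mul_log_zero hr h]
    ring
  · exact hconst R hR (not_le.1 h).le

lemma realPotential_discMeasure {s : ℝ} (hs : 0 ≤ s) (z : ℂ) :
    realPotential (discMeasure s) z = discPotential s (‖z‖ ^ 2) := by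
  rw [realPotential_discMeasure_eq_integral,
    integral_norm_discMeasure (fun y => Real.log (max y ‖z‖)),
    integral_mul_log_max (norm_nonneg z) (Real.sqrt_nonneg s), discPotential, Real.sq_sqrt hs,
    log_norm_sq, Real.log_sqrt hs]
  simp only [Real.le_sqrt (norm_nonneg z) hs]
  split_ifs <;> ring

/-- From `log u ≤ u - 1` at `u = y / x`: the function `y ↦ x log y - y` peaks at `y = x`. Outside
the contact set this gives the obstacle inequality. -/
lemma mul_log_sub_le {x y : ℝ} (hx : 0 ≤ x) (hy : 0 < y) :
    x * Real.log y - y ≤ x * Real.log x - x := by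
  rcases hx.eq_or_lt with rfl | hx
  · simpa using hy.le
  have h := Real.log_le_sub_one_of_pos (div_pos hy hx)
  rw [Real.log_div hy.ne' hx.ne'] at h
  have h1 := mul_le_mul_of_nonneg_left h hx.le
  have h2 : x * (y / x - 1) = y - x := by field_simp
  rw [h2] at h1
  linarith

lemma le_discPotential {s σ : ℝ} (hs : 0 ≤ s) (hσ : 0 ≤ σ) :
    (s * Real.log s - s) / 2 ≤ discPotential s σ := by
  unfold discPotential
  split_ifs with h
  · linarith
  · push Not at h
    rcases hs.eq_or_lt with rfl | hs
    · simp
    · have := mul_le_mul_of_nonneg_left (Real.log_le_log hs h.le) hs.le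
      linarith

lemma HasLogMoment.logIntegrable_discMeasure [IsFiniteMeasure μ] (hμ : HasLogMoment μ) {s : ℝ}
    (hs : 0 ≤ s) : LogIntegrable μ (discMeasure s) :=
  logIntegrable_of_potential hμ (hasLogMoment_discMeasure s) (potentialFinite_discMeasure s)
    fun z => by
      rw [realPotential_discMeasure hs]
      exact le_discPotential hs (sq_nonneg ‖z‖)

end Radial

end LogEnergy
namespace LogEnergy

/-! ### The functional as a real number -/

section Functional

variable {α : ℝ} {μ ν : Measure ℂ}

/-- Half of `B_α(ν)` as a real number. -/
noncomputable def halfSup (α : ℝ) (ν : Measure ℂ) : ℝ :=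
  (⨆ w : ℂ, (logPotential ν w - ((‖w‖ ^ 2 / (2 * α) : ℝ) : EReal))).toReal

lemma exists_potentialFinite [IsFiniteMeasure ν] (hν : HasLogMoment ν) :
    ∃ w, PotentialFinite ν w :=
  (hν.logIntegrable_circleMeasure one_pos).symm.ae_potential.exists

lemma realPotential_le [IsProbabilityMeasure ν] (hν : HasLogMoment ν) {w : ℂ}
    (hw : PotentialFinite ν w) :
    realPotential ν w ≤ Real.log (1 + ‖w‖) + ∫ z, Real.log (1 + ‖z‖) ∂ν := by
  have h := integral_mono hw.2 ((integrable_const (Real.log (1 + ‖w‖))).add hν)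
    fun z => log_norm_sub_le w z
  simp only [Pi.add_apply] at h
  rw [integral_add (integrable_const _) hν, integral_const, probReal_univ, one_smul] at h
  exact h

/-- The quadratic confinement dominates the logarithmic growth of potentials, so the supremum in
`B_α` is finite. -/
lemma log_one_add_norm_le_sq (hα : 0 < α) (w : ℂ) :
    Real.log (1 + ‖w‖) ≤ ‖w‖ ^ 2 / (2 * α) + α / 2 := by
  have h1 : Real.log (1 + ‖w‖) ≤ ‖w‖ := by
    have := Real.log_le_sub_one_of_pos (x := 1 + ‖w‖) (by positivity)
    linarith
  have h2 : ‖w‖ ≤ ‖w‖ ^ 2 / (2 * α) + α / 2 := by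
    rw [div_add_div _ _ (by positivity) two_ne_zero, le_div_iff₀ (by positivity)]
    nlinarith [sq_nonneg (‖w‖ - α)]
  exact h1.trans h2

lemma coe_halfSup (hα : 0 < α) [IsProbabilityMeasure ν] (hν : HasLogMoment ν) :
    ((halfSup α ν : ℝ) : EReal) =
      ⨆ w : ℂ, (logPotential ν w - ((‖w‖ ^ 2 / (2 * α) : ℝ) : EReal)) := by
  refine EReal.coe_toReal ?_ ?_
  · refine ne_top_of_le_ne_top (EReal.coe_ne_top (α / 2 + ∫ z, Real.log (1 + ‖z‖) ∂ν))
      (iSup_le fun w => ?_)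
    by_cases h : PotentialFinite ν w
    · rw [logPotential_eq h, ← EReal.coe_sub, EReal.coe_le_coe_iff]
      linarith [realPotential_le hν h, log_one_add_norm_le_sq hα w]
    · rw [logPotential_eq_bot hν h, EReal.bot_sub]
      exact bot_le
  · obtain ⟨w, hw⟩ := exists_potentialFinite hν
    refine ne_bot_of_le_ne_bot ?_ (le_iSup _ w)
    rw [logPotential_eq hw, ← EReal.coe_sub]
    exact EReal.coe_ne_bot _

lemma supTerm_eq (hα : 0 < α) [IsProbabilityMeasure ν] (hν : HasLogMoment ν) :
    supTerm α ν = ((2 * halfSup α ν : ℝ) : EReal) := by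
  rw [supTerm, ← coe_halfSup hα hν, EReal.coe_mul]
  rfl

lemma realPotential_le_halfSup (hα : 0 < α) [IsProbabilityMeasure ν] (hν : HasLogMoment ν) {w : ℂ}
    (hw : PotentialFinite ν w) : realPotential ν w ≤ ‖w‖ ^ 2 / (2 * α) + halfSup α ν := by
  have h := le_iSup (fun w : ℂ => logPotential ν w - ((‖w‖ ^ 2 / (2 * α) : ℝ) : EReal)) w
  rw [← coe_halfSup hα hν, logPotential_eq hw, ← EReal.coe_sub, EReal.coe_le_coe_iff] at h
  linarith

/-- Points where the potential is `-∞` contribute nothing to the supremum. -/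
lemma halfSup_le (hα : 0 < α) [IsProbabilityMeasure ν] (hν : HasLogMoment ν) {c : ℝ}
    (h : ∀ w, PotentialFinite ν w → realPotential ν w ≤ ‖w‖ ^ 2 / (2 * α) + c) :
    halfSup α ν ≤ c := by
  rw [← EReal.coe_le_coe_iff, coe_halfSup hα hν]
  refine iSup_le fun w => ?_
  by_cases hw : PotentialFinite ν w
  · rw [logPotential_eq hw, ← EReal.coe_sub, EReal.coe_le_coe_iff]
    linarith [h w hw]
  · rw [logPotential_eq_bot hν hw, EReal.bot_sub]
    exact bot_le

lemma PotentialFinite.of_smul {w : ℂ} {c : ℝ≥0} (hc : c ≠ 0) (h : PotentialFinite (c • μ) w) :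
    PotentialFinite μ w := by
  have h1 : μ = ((c⁻¹ : ℝ≥0) : ℝ≥0∞) • (c • μ) := by
    rw [← ENNReal.smul_def, smul_smul, inv_mul_cancel₀ hc, one_smul]
  rw [h1]
  exact h.smul ENNReal.coe_ne_top

lemma HasLogMoment.add (h1 : HasLogMoment μ) (h2 : HasLogMoment ν) : HasLogMoment (μ + ν) :=
  h1.add_measure h2

lemma HasLogMoment.smul (h : HasLogMoment μ) (c : ℝ≥0) : HasLogMoment (c • μ) :=
  Integrable.smul_measure h ENNReal.coe_ne_top

/-- A supremum of functions affine in the measure is convex. Nonzero weights ensure that a finite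
potential of the combination forces finite potentials of both measures. -/
lemma halfSup_convex (hα : 0 < α) [IsProbabilityMeasure μ] [IsProbabilityMeasure ν]
    (hμ : HasLogMoment μ) (hν : HasLogMoment ν) {a b : ℝ≥0} (ha : a ≠ 0) (hb : b ≠ 0)
    [IsProbabilityMeasure (a • μ + b • ν)] (hab : a + b = 1) :
    halfSup α (a • μ + b • ν) ≤ a * halfSup α μ + b * halfSup α ν := by
  refine halfSup_le hα ((hμ.smul a).add (hν.smul b)) fun w hw => ?_
  have h1 := hw.mono (Measure.le_add_right le_rfl)
  have h2 := hw.mono (Measure.le_add_left le_rfl)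
  have e1 : realPotential (a • μ) w = a * realPotential μ w := realPotential_smul (a : ℝ≥0∞) w
  have e2 : realPotential (b • ν) w = b * realPotential ν w := realPotential_smul (b : ℝ≥0∞) w
  rw [h1.realPotential_add h2, e1, e2]
  have h3 := realPotential_le_halfSup hα hμ (h1.of_smul ha)
  have h4 := realPotential_le_halfSup hα hν (h2.of_smul hb)
  have hab' : (a : ℝ) + b = 1 := by exact_mod_cast hab
  have h5 := mul_le_mul_of_nonneg_left h3 a.2
  have h6 := mul_le_mul_of_nonneg_left h4 b.2
  have h7 : ‖w‖ ^ 2 / (2 * α) = (a + b) * (‖w‖ ^ 2 / (2 * α)) := by rw [hab', one_mul]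
  rw [h7]
  simp only [NNReal.val_eq_coe] at h5 h6
  linarith

/-- Integrates the pointwise bound `U_ν(w) ≤ |w|²/(2α) + B_α(ν)/2` against `ρ`. The freedom in `ρ`
is what the comparison with shifted circles exploits. -/
lemma realEnergy_le_halfSup (hα : 0 < α) [IsProbabilityMeasure ν] (hν : HasLogMoment ν)
    {ρ : Measure ℂ} [IsProbabilityMeasure ρ] (h : LogIntegrable ν ρ)
    (hρ : Integrable (fun w : ℂ => ‖w‖ ^ 2) ρ) :
    realEnergy ν ρ ≤ (∫ w, ‖w‖ ^ 2 ∂ρ) / (2 * α) + halfSup α ν := by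
  rw [realEnergy_comm, ← h.symm.integral_potential]
  have h1 := integral_mono_ae h.symm.integrable_potential
    ((hρ.div_const (2 * α)).add (integrable_const (halfSup α ν)))
    (h.symm.ae_potential.mono fun w hw => realPotential_le_halfSup hα hν hw)
  simp only [Pi.add_apply] at h1
  rw [integral_add (hρ.div_const _) (integrable_const _), integral_div] at h1
  simpa using h1

lemma LogIntegrable.energyFunctional_eq (hα : 0 < α) [IsProbabilityMeasure ν]
    (h : LogIntegrable ν ν) :
    energyFunctional α ν = ((2 * halfSup α ν - realEnergy ν ν : ℝ) : EReal) := by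
  rw [energyFunctional, supTerm_eq hα h.hasLogMoment, logEnergy, h.mutualEnergy_eq, EReal.coe_sub]

lemma energyFunctional_eq_top (hα : 0 < α) [IsProbabilityMeasure ν] (hν : HasLogMoment ν)
    (h : ¬ LogIntegrable ν ν) : energyFunctional α ν = ⊤ := by
  rw [energyFunctional, supTerm_eq hα hν, logEnergy, mutualEnergy_eq_bot hν hν h]
  exact EReal.coe_sub_bot _

end Functional

/-! ### First-order conditions over convex families -/

section Variational

variable {α : ℝ} {C : Set (ProbabilityMeasure ℂ)} {μ ν : ProbabilityMeasure ℂ}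

lemma IsConvexFamily.exists_combination (hC : IsConvexFamily C) (hμ : μ ∈ C) (hν : ν ∈ C)
    {a b : ℝ≥0} (hab : a + b = 1) :
    ∃ ρ ∈ C, (ρ : Measure ℂ) = a • (μ : Measure ℂ) + b • (ν : Measure ℂ) :=
  hC ⟨μ, hμ, rfl⟩ ⟨ν, hν, rfl⟩ a.2 b.2 hab

lemma nonneg_of_forall_add_mul_nonneg {x y : ℝ} (h : ∀ t : ℝ, 0 < t → t < 1 → 0 ≤ x + t * y) :
    0 ≤ x := by
  by_contra! hx
  have hy : 0 < |y| + 1 - x := by linarith [abs_nonneg y]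
  -- This `t` lies in `(0, 1)` and satisfies `t y ≤ -x / 2`, so `x + t y ≤ x / 2 < 0`.
  have h1 := h (-x / (2 * (|y| + 1 - x))) (div_pos (by linarith) (by linarith))
    ((div_lt_one (by linarith)).2 (by linarith [abs_nonneg y]))
  have h2 : -x / (2 * (|y| + 1 - x)) * y ≤ -x / 2 := by
    rw [div_mul_eq_mul_div, div_le_div_iff₀ (by linarith) two_pos]
    nlinarith [le_abs_self y]
  linarith

lemma realEnergy_combination {μ ν : Measure ℂ} [IsFiniteMeasure μ] [IsFiniteMeasure ν]
    (hμ : LogIntegrable μ μ) (hν : LogIntegrable ν ν) (hμν : LogIntegrable μ ν) (a b : ℝ≥0) :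
    LogIntegrable (a • μ + b • ν) (a • μ + b • ν) ∧
    realEnergy (a • μ + b • ν) (a • μ + b • ν) =
      a ^ 2 * realEnergy μ μ + 2 * a * b * realEnergy μ ν + b ^ 2 * realEnergy ν ν := by
  change LogIntegrable ((a : ℝ≥0∞) • μ + (b : ℝ≥0∞) • ν) ((a : ℝ≥0∞) • μ + (b : ℝ≥0∞) • ν) ∧
    realEnergy ((a : ℝ≥0∞) • μ + (b : ℝ≥0∞) • ν) ((a : ℝ≥0∞) • μ + (b : ℝ≥0∞) • ν) = _
  have ha : (a : ℝ≥0∞) ≠ ⊤ := ENNReal.coe_ne_top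
  have hb : (b : ℝ≥0∞) ≠ ⊤ := ENNReal.coe_ne_top
  have : IsFiniteMeasure ((a : ℝ≥0∞) • μ) := Measure.smul_finite μ ha
  have : IsFiniteMeasure ((b : ℝ≥0∞) • ν) := Measure.smul_finite ν hb
  have h11 := (hμ.smul_left ha).smul_right ha
  have h12 := (hμν.smul_left ha).smul_right hb
  have h21 := (hμν.symm.smul_left hb).smul_right ha
  have h22 := (hν.smul_left hb).smul_right hb
  refine ⟨(h11.add_right h12).add_left (h21.add_right h22), ?_⟩
  rw [(h11.add_right h12).realEnergy_add_left (h21.add_right h22), h11.realEnergy_add_right h12,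
    h21.realEnergy_add_right h22]
  simp only [realEnergy_smul_left, realEnergy_smul_right, ENNReal.coe_toReal]
  rw [realEnergy_comm (μ := ν) (ν := μ)]
  ring

/-- First order optimality of a minimizer over a convex family. -/
lemma IsMinimizer.realEnergy_sub_le (hα : 0 < α) (hC : IsConvexFamily C)
    (hmin : IsMinimizer α C μ) (hμ : LogIntegrable μ μ) (hνC : ν ∈ C) (hν : LogIntegrable ν ν) :
    realEnergy μ ν - halfSup α ν ≤ realEnergy μ μ - halfSup α μ := by
  have hμν := hμ.cross hν
  suffices h : 0 ≤ 2 * (realEnergy μ μ - halfSup α μ - (realEnergy μ ν - halfSup α ν)) by linarith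
  -- Along `(1 - t) μ + t ν`, convexity of `halfSup` and the quadratic expansion of the energy bound
  -- the increase of the functional by `t` times this expression; `y` collects the second-order
  -- energy terms.
  refine nonneg_of_forall_add_mul_nonneg
    (y := 2 * realEnergy μ ν - realEnergy μ μ - realEnergy ν ν) fun t ht0 ht1 => ?_
  lift t to ℝ≥0 using ht0.le
  obtain ⟨a, ha⟩ : ∃ a : ℝ≥0, (a : ℝ) = 1 - t := ⟨⟨1 - t, by linarith⟩, rfl⟩
  have hab : a + t = 1 := by
    ext
    push_cast
    linarith
  obtain ⟨ρ, hρC, hρ⟩ := hC.exists_combination hmin.1 hνC hab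
  obtain ⟨hL, hE⟩ := realEnergy_combination hμ hν hμν a t
  have hP : IsProbabilityMeasure (a • (μ : Measure ℂ) + t • (ν : Measure ℂ)) :=
    hρ ▸ (inferInstance : IsProbabilityMeasure (ρ : Measure ℂ))
  have hS := halfSup_convex hα hμ.hasLogMoment hν.hasLogMoment (a := a) (b := t)
    (NNReal.coe_ne_zero.1 (by linarith)) (NNReal.coe_ne_zero.1 ht0.ne') hab
  rw [← hρ] at hL hE hS
  have hle := hmin.2.2 ρ hρC hL.hasLogMoment
  rw [hμ.energyFunctional_eq hα, hL.energyFunctional_eq hα, EReal.coe_le_coe_iff] at hle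
  rw [ha] at hE hS
  rw [hE] at hle
  have : 0 ≤ t * (2 * (realEnergy μ μ - halfSup α μ - (realEnergy μ ν - halfSup α ν)) +
      t * (2 * realEnergy μ ν - realEnergy μ μ - realEnergy ν ν)) := by
    nlinarith
  exact nonneg_of_mul_nonneg_right this ht0

/-- The Jordan parts are the truncated differences `ν - μ` and `μ - ν`. They are dominated by `ν`
and `μ`, so every energy involved is finite. -/
lemma signedLogEnergy_sub {μ ν : Measure ℂ} [IsFiniteMeasure μ] [IsFiniteMeasure ν]
    (hμ : LogIntegrable μ μ) (hν : LogIntegrable ν ν) (hμν : LogIntegrable μ ν) :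
    signedLogEnergy (ν.toSignedMeasure - μ.toSignedMeasure) =
      ((realEnergy ν ν + realEnergy μ μ - 2 * realEnergy μ ν : ℝ) : EReal) := by
  have hP : ν - μ ≤ ν := Measure.sub_le
  have hN : μ - ν ≤ μ := Measure.sub_le
  have hadd : ν + (μ - ν) = μ + (ν - μ) := by
    rw [← Measure.toSignedMeasure_eq_toSignedMeasure_iff]
    have := Measure.sub_toSignedMeasure_eq_toSignedMeasure_sub (μ := ν) (ν := μ)
    rw [Measure.toSignedMeasure_add, Measure.toSignedMeasure_add]
    rw [sub_eq_sub_iff_add_eq_add] at this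
    rw [this, add_comm]
  have hPP := hν.mono hP hP
  have hNN := hμ.mono hN hN
  have hPN := hμν.symm.mono hP hN
  -- Pairing `ν + (μ - ν) = μ + (ν - μ)` with each of the four measures gives linear relations from
  -- which the bilinear expansion follows.
  have key : ∀ X : Measure ℂ, IsFiniteMeasure X → LogIntegrable ν X → LogIntegrable μ X →
      realEnergy ν X + realEnergy (μ - ν) X = realEnergy μ X + realEnergy (ν - μ) X := by
    intro X _ h1 h2
    rw [← h1.realEnergy_add_left (h2.mono hN le_rfl), ← h2.realEnergy_add_left (h1.mono hP le_rfl),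
      hadd]
  have k1 := key ν inferInstance hν hμν
  have k2 := key μ inferInstance hμν.symm hμ
  have k3 := key (ν - μ) inferInstance (hν.mono le_rfl hP) (hμν.mono le_rfl hP)
  have k4 := key (μ - ν) inferInstance (hμν.symm.mono le_rfl hN) (hμ.mono le_rfl hN)
  unfold signedLogEnergy
  rw [Measure.toJordanDecomposition_toSignedMeasure_sub,
    Measure.jordanDecompositionOfToSignedMeasureSub_posPart,
    Measure.jordanDecompositionOfToSignedMeasureSub_negPart]
  simp only [logEnergy]
  rw [hPP.mutualEnergy_eq, hNN.mutualEnergy_eq, hPN.mutualEnergy_eq, ← EReal.coe_add,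
    show (2 : EReal) = ((2 : ℝ) : EReal) from rfl, ← EReal.coe_mul, ← EReal.coe_sub]
  congr 1
  rw [realEnergy_comm (μ := ν) (ν := μ)] at k2
  rw [realEnergy_comm (μ := ν) (ν := ν - μ), realEnergy_comm (μ := μ) (ν := ν - μ),
    realEnergy_comm (μ := μ - ν) (ν := ν - μ)] at k3
  rw [realEnergy_comm (μ := ν) (ν := μ - ν), realEnergy_comm (μ := μ) (ν := μ - ν)] at k4
  linarith

/-- A candidate is tested against the minimizer, and the minimizer's first-order condition is tested
at the candidate. In the sum the `halfSup` terms cancel, leaving the equality case of positive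
definiteness. -/
theorem variational_characterization (hα : 0 < α) (hC : IsConvexFamily C)
    (hmin : IsMinimizer α C μ) (hμ : LogIntegrable μ μ) (hνC : ν ∈ C) (hν : LogIntegrable ν ν) :
    (∀ ρ ∈ C, FiniteLogEnergy ρ →
      eintegral ν (logPotential ρ) - supTerm α ρ / 2 ≤
        eintegral ν (logPotential ν) - supTerm α ν / 2) ↔ ν = μ := by
  have conv : ∀ ρ σ : ProbabilityMeasure ℂ, LogIntegrable ρ σ → HasLogMoment σ →
      eintegral ρ (logPotential σ) - supTerm α σ / 2 =
        ((realEnergy ρ σ - halfSup α σ : ℝ) : EReal) := by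
    intro ρ σ h hσ
    rw [h.eintegral_logPotential, supTerm_eq hα hσ, show (2 : EReal) = ((2 : ℝ) : EReal) from rfl,
      ← EReal.coe_div, ← EReal.coe_sub]
    congr 1
    ring
  constructor
  · intro h
    have h1 := h μ hmin.1 (by
      constructor <;> rw [logEnergy, hμ.mutualEnergy_eq]
      · exact EReal.coe_ne_bot _
      · exact EReal.coe_ne_top _)
    rw [conv ν μ (hν.cross hμ) hμ.hasLogMoment, conv ν ν hν hν.hasLogMoment,
      EReal.coe_le_coe_iff] at h1
    have h2 := hmin.realEnergy_sub_le hα hC hμ hνC hν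
    rw [realEnergy_comm (μ := (μ : Measure ℂ)) (ν := ν)] at h2
    have h3 := eq_of_two_mul_realEnergy_le hν hμ (by linarith)
    exact Subtype.ext h3
  · rintro rfl ρ hρC hρ
    have hρ' := hρ.logIntegrable
    rw [conv ν ρ (hμ.cross hρ') hρ'.hasLogMoment, conv ν ν hμ hμ.hasLogMoment,
      EReal.coe_le_coe_iff]
    exact hmin.realEnergy_sub_le hα hC hμ hρC hρ'

/-- For finite energy this is twice the first-order condition, rearranged; otherwise the right-hand
side is `⊤`. -/
theorem neg_signedLogEnergy_le (hα : 0 < α) (hC : IsConvexFamily C)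
    (hmin : IsMinimizer α C μ) (hμ : LogIntegrable μ μ) (hνC : ν ∈ C) (hν : HasLogMoment ν) :
    -signedLogEnergy ((ν : Measure ℂ).toSignedMeasure - (μ : Measure ℂ).toSignedMeasure) ≤
      energyFunctional α ν - energyFunctional α μ := by
  by_cases h : LogIntegrable ν ν
  · rw [signedLogEnergy_sub hμ h (hμ.cross h), h.energyFunctional_eq hα, hμ.energyFunctional_eq hα,
      ← EReal.coe_neg, ← EReal.coe_sub, EReal.coe_le_coe_iff]
    linarith [hmin.realEnergy_sub_le hα hC hμ hνC h]
  · rw [energyFunctional_eq_top hα hν h, hμ.energyFunctional_eq hα, EReal.top_sub_coe]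
    exact le_top

end Variational

end LogEnergy
namespace LogEnergy

/-! ### The candidate measures and their shifted versions -/

section RadialMeasure

variable {α a b t : ℝ}

/-- The absolutely continuous part of `radialMeasure α a b`. -/
noncomputable def radialPart (α a b : ℝ) : Measure ℂ :=
  ENNReal.ofReal (1 / α) • discMeasure a +
    ENNReal.ofReal (1 / (α * Real.pi)) • volume.restrict {z : ℂ | √b ≤ ‖z‖ ∧ ‖z‖ ≤ √α}

/-- `radialMeasure α a b` with the singular part moved to the circle of radius `t`. -/
noncomputable def shiftedMeasure (α a b t : ℝ) : Measure ℂ :=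
  radialPart α a b + ENNReal.ofReal ((b - a) / α) • circleMeasure t

lemma setOf_norm_le (r : ℝ) : {z : ℂ | ‖z‖ ≤ r} = Metric.closedBall 0 r := by
  ext z; simp

lemma smul_restrict_closedBall (hα : 0 < α) (s : ℝ) :
    ENNReal.ofReal (1 / (α * Real.pi)) • volume.restrict (Metric.closedBall (0 : ℂ) √s) =
      ENNReal.ofReal (1 / α) • discMeasure s := by
  rw [discMeasure, smul_smul, ← ENNReal.ofReal_mul (by positivity), one_div_mul_one_div]

lemma radialMeasure_eq (hα : 0 < α) : radialMeasure α a b = shiftedMeasure α a b 1 := by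
  rw [radialMeasure, shiftedMeasure, radialPart, circleUniform_eq, smul_add, setOf_norm_le,
    smul_restrict_closedBall hα]

lemma measurableSet_annulus (r R : ℝ) : MeasurableSet {z : ℂ | r ≤ ‖z‖ ∧ ‖z‖ ≤ R} :=
  (measurableSet_le measurable_const measurable_norm).inter
    (measurableSet_le measurable_norm measurable_const)

lemma restrict_annulus_add {r R : ℝ} (h : r ≤ R) :
    (volume : Measure ℂ).restrict {z : ℂ | r ≤ ‖z‖ ∧ ‖z‖ ≤ R} +
      volume.restrict (Metric.closedBall 0 r) = volume.restrict (Metric.closedBall 0 R) := by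
  rw [← Measure.restrict_union₀]
  · congr 1
    ext z
    simp only [mem_union, mem_ofPred_eq, mem_closedBall_zero_iff]
    constructor
    · rintro (h1 | h1)
      · exact h1.2
      · exact h1.trans h
    · intro h1
      rcases le_total ‖z‖ r with h2 | h2
      · exact Or.inr h2
      · exact Or.inl ⟨h2, h1⟩
  · refine measure_mono_null ?_ (Measure.addHaar_sphere volume (0 : ℂ) r)
    rintro z ⟨⟨h1, -⟩, h2⟩
    rw [mem_closedBall_zero_iff] at h2
    rw [mem_sphere_zero_iff_norm]
    exact le_antisymm h2 h1
  · exact Metric.isClosed_closedBall.measurableSet.nullMeasurableSet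

/-- The annulus is a difference of discs, written additively to avoid subtracting measures. All
integrals over `radialPart` follow from those over three discs. -/
lemma radialPart_add (hα : 0 < α) (hb : b ≤ α) :
    radialPart α a b + ENNReal.ofReal (1 / α) • discMeasure b =
      ENNReal.ofReal (1 / α) • (discMeasure a + discMeasure α) := by
  rw [radialPart, add_assoc, ← smul_restrict_closedBall hα b, ← smul_add,
    restrict_annulus_add (Real.sqrt_le_sqrt hb), smul_restrict_closedBall hα, smul_add]

lemma radialPart_le (hα : 0 < α) (hb : b ≤ α) :
    radialPart α a b ≤ ENNReal.ofReal (1 / α) • (discMeasure a + discMeasure α) := by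
  rw [← radialPart_add hα hb]
  exact Measure.le_add_right le_rfl

lemma isFiniteMeasure_radialPart (hα : 0 < α) (hb : b ≤ α) :
    IsFiniteMeasure (radialPart α a b) := by
  have : IsFiniteMeasure (ENNReal.ofReal (1 / α) • (discMeasure a + discMeasure α)) :=
    Measure.smul_finite _ ENNReal.ofReal_ne_top
  exact isFiniteMeasure_of_le _ (radialPart_le hα hb)

lemma integrable_and_integral_radialPart (hα : 0 < α) (hb : b ≤ α) {F : ℂ → ℝ}
    (h1 : Integrable F (discMeasure a)) (h2 : Integrable F (discMeasure α))
    (h3 : Integrable F (discMeasure b)) :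
    Integrable F (radialPart α a b) ∧
    ∫ z, F z ∂radialPart α a b = 1 / α *
      (∫ z, F z ∂discMeasure a + ∫ z, F z ∂discMeasure α - ∫ z, F z ∂discMeasure b) := by
  have i : Integrable F (radialPart α a b) :=
    ((h1.add_measure h2).smul_measure ENNReal.ofReal_ne_top).mono_measure (radialPart_le hα hb)
  refine ⟨i, ?_⟩
  have h := congrArg (fun m => ∫ z, F z ∂m) (radialPart_add (a := a) hα hb)
  rw [integral_add_measure i (h3.smul_measure ENNReal.ofReal_ne_top), integral_smul_measure,
    integral_smul_measure, integral_add_measure h1 h2, ENNReal.toReal_ofReal (by positivity),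
    smul_eq_mul, smul_eq_mul] at h
  linarith

lemma radialPart_real_univ (hα : 0 < α) (ha : 0 ≤ a) (hb0 : 0 ≤ b) (hb : b ≤ α) :
    (radialPart α a b).real univ = 1 / α * (a + α - b) := by
  have h := (integrable_and_integral_radialPart (a := a) hα hb (integrable_const (1 : ℝ))
    (integrable_const 1) (integrable_const 1)).2
  simp only [integral_const, smul_eq_mul, mul_one] at h
  rw [h, measureReal_def, measureReal_def, measureReal_def, discMeasure_univ ha,
    discMeasure_univ hb0, discMeasure_univ hα.le, ENNReal.toReal_ofReal ha,
    ENNReal.toReal_ofReal hb0, ENNReal.toReal_ofReal hα.le]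

lemma integrable_norm_sq_discMeasure (s : ℝ) :
    Integrable (fun z : ℂ => ‖z‖ ^ 2) (discMeasure s) := by
  refine Integrable.mono' (integrable_const (√s ^ 2)) (by fun_prop) ?_
  filter_upwards [norm_le_ae_discMeasure s] with z hz
  rw [Real.norm_of_nonneg (by positivity)]
  gcongr

lemma integral_norm_sq_radialPart (hα : 0 < α) (ha : 0 ≤ a) (hb0 : 0 ≤ b) (hb : b ≤ α) :
    Integrable (fun z : ℂ => ‖z‖ ^ 2) (radialPart α a b) ∧
    ∫ z, ‖z‖ ^ 2 ∂radialPart α a b = 1 / α * ((a ^ 2 + α ^ 2 - b ^ 2) / 2) := by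
  obtain ⟨h1, h2⟩ := integrable_and_integral_radialPart (a := a) hα hb
    (integrable_norm_sq_discMeasure a) (integrable_norm_sq_discMeasure α)
    (integrable_norm_sq_discMeasure b)
  refine ⟨h1, ?_⟩
  rw [h2, integral_norm_sq_discMeasure ha, integral_norm_sq_discMeasure hb0,
    integral_norm_sq_discMeasure hα.le]
  ring

lemma potentialFinite_radialPart (hα : 0 < α) (hb : b ≤ α) (z : ℂ) :
    PotentialFinite (radialPart α a b) z :=
  (((potentialFinite_discMeasure a z).add (potentialFinite_discMeasure α z)).smul
    ENNReal.ofReal_ne_top).mono (radialPart_le hα hb)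

lemma realPotential_radialPart (hα : 0 < α) (ha : 0 ≤ a) (hb0 : 0 ≤ b) (hb : b ≤ α) (z : ℂ) :
    realPotential (radialPart α a b) z = 1 / α *
      (discPotential a (‖z‖ ^ 2) + discPotential α (‖z‖ ^ 2) - discPotential b (‖z‖ ^ 2)) := by
  rw [← realPotential_discMeasure ha, ← realPotential_discMeasure hb0,
    ← realPotential_discMeasure hα.le]
  exact (integrable_and_integral_radialPart hα hb (potentialFinite_discMeasure a z).2
    (potentialFinite_discMeasure α z).2 (potentialFinite_discMeasure b z).2).2

lemma HasLogMoment.logIntegrable_radialPart {ν : Measure ℂ} [IsFiniteMeasure ν]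
    (hν : HasLogMoment ν) (hα : 0 < α) (ha : 0 ≤ a) (hb : b ≤ α) :
    LogIntegrable ν (radialPart α a b) := by
  have := isFiniteMeasure_radialPart (a := a) hα hb
  exact (((hν.logIntegrable_discMeasure ha).add_right
    (hν.logIntegrable_discMeasure hα.le)).smul_right ENNReal.ofReal_ne_top).mono le_rfl
    (radialPart_le hα hb)

lemma isProbabilityMeasure_shiftedMeasure (hα : 0 < α) (ha : 0 ≤ a) (hab : a ≤ b) (hb : b ≤ α) :
    IsProbabilityMeasure (shiftedMeasure α a b t) := by
  have := isFiniteMeasure_radialPart (a := a) hα hb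
  have h0 : 0 ≤ (b - a) / α := div_nonneg (by linarith) hα.le
  have h1 : 0 ≤ 1 / α * (a + α - b) := mul_nonneg (by positivity) (by linarith)
  refine ⟨?_⟩
  rw [shiftedMeasure, Measure.add_apply, Measure.smul_apply,
    measure_univ (μ := circleMeasure t), smul_eq_mul, mul_one,
    ← ofReal_measureReal (measure_ne_top _ _), radialPart_real_univ hα ha (ha.trans hab) hb,
    ← ENNReal.ofReal_add h1 h0, ← ENNReal.ofReal_one]
  congr 1
  field_simp
  ring

lemma integrable_norm_sq_shiftedMeasure (hα : 0 < α) (ha : 0 ≤ a) (hab : a ≤ b) (hb : b ≤ α)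
    (ht : 0 ≤ t) :
    Integrable (fun z : ℂ => ‖z‖ ^ 2) (shiftedMeasure α a b t) ∧
    ∫ z, ‖z‖ ^ 2 ∂shiftedMeasure α a b t =
      1 / α * ((a ^ 2 + α ^ 2 - b ^ 2) / 2) + (b - a) / α * t ^ 2 := by
  obtain ⟨h1, h2⟩ := integral_norm_sq_radialPart hα ha (ha.trans hab) hb
  have h0 : 0 ≤ (b - a) / α := div_nonneg (by linarith) hα.le
  have e : (fun z : ℂ => ‖z‖ ^ 2) =ᵐ[circleMeasure t] fun _ => t ^ 2 := by
    filter_upwards [norm_eq_ae_circleMeasure ht] with z hz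
    rw [hz]
  have h3 : Integrable (fun z : ℂ => ‖z‖ ^ 2) (circleMeasure t) :=
    (integrable_const (t ^ 2)).congr e.symm
  refine ⟨h1.add_measure (h3.smul_measure ENNReal.ofReal_ne_top), ?_⟩
  rw [shiftedMeasure, integral_add_measure h1 (h3.smul_measure ENNReal.ofReal_ne_top), h2,
    integral_smul_measure, integral_congr_ae e, ENNReal.toReal_ofReal h0]
  simp

lemma hasLogMoment_shiftedMeasure (hα : 0 < α) (hb : b ≤ α) (ht : 0 ≤ t) :
    HasLogMoment (shiftedMeasure α a b t) := by
  have h1 : HasLogMoment (radialPart α a b) :=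
    (((hasLogMoment_discMeasure a).add_measure (hasLogMoment_discMeasure α)).smul_measure
      ENNReal.ofReal_ne_top).mono_measure (radialPart_le hα hb)
  exact h1.add ((hasLogMoment_circleMeasure ht).smul_measure ENNReal.ofReal_ne_top)

lemma logIntegrable_shiftedMeasure {ν : Measure ℂ} [IsFiniteMeasure ν]
    (hν : HasLogMoment ν) (hα : 0 < α) (ha : 0 ≤ a) (hab : a ≤ b) (hb : b ≤ α)
    (hc : LogIntegrable ν (circleMeasure t)) :
    LogIntegrable ν (shiftedMeasure α a b t) ∧
    realEnergy ν (shiftedMeasure α a b t) = realEnergy ν (radialPart α a b) +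
      (b - a) / α * realEnergy ν (circleMeasure t) := by
  have := isFiniteMeasure_radialPart (a := a) hα hb
  have h0 : 0 ≤ (b - a) / α := div_nonneg (by linarith) hα.le
  have : IsFiniteMeasure (ENNReal.ofReal ((b - a) / α) • circleMeasure t) :=
    Measure.smul_finite _ ENNReal.ofReal_ne_top
  have h1 := hν.logIntegrable_radialPart hα ha hb
  have h2 := hc.smul_right (c := ENNReal.ofReal ((b - a) / α)) ENNReal.ofReal_ne_top
  refine ⟨h1.add_right h2, ?_⟩
  rw [shiftedMeasure, h1.realEnergy_add_right h2, realEnergy_smul_right, ENNReal.toReal_ofReal h0]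

lemma potentialFinite_shiftedMeasure (hα : 0 < α) (hb : b ≤ α) (ht : t ≠ 0) (z : ℂ) :
    PotentialFinite (shiftedMeasure α a b t) z :=
  (potentialFinite_radialPart hα hb z).add
    ((potentialFinite_circleMeasure ht z).smul ENNReal.ofReal_ne_top)

lemma realPotential_shiftedMeasure_one (hα : 0 < α) (ha : 0 ≤ a) (hab : a ≤ b) (hb : b ≤ α)
    (z : ℂ) :
    realPotential (shiftedMeasure α a b 1) z = 1 / α *
      (discPotential a (‖z‖ ^ 2) + discPotential α (‖z‖ ^ 2) - discPotential b (‖z‖ ^ 2) +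
        (b - a) / 2 * Real.log (max (‖z‖ ^ 2) 1)) := by
  have h0 : 0 ≤ (b - a) / α := div_nonneg (by linarith) hα.le
  have h1 : Real.log (max (‖z‖ ^ 2) 1) = 2 * Real.log (max ‖z‖ 1) := by
    rw [← Real.log_rpow (by positivity)]
    congr 1
    rw [Real.rpow_two]
    rcases le_total ‖z‖ 1 with h | h
    · rw [max_eq_right h, max_eq_right (pow_le_one₀ (norm_nonneg z) h), one_pow]
    · rw [max_eq_left h, max_eq_left (one_le_pow₀ h)]
  rw [shiftedMeasure, (potentialFinite_radialPart hα hb z).realPotential_add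
    ((potentialFinite_circleMeasure one_ne_zero z).smul ENNReal.ofReal_ne_top),
    realPotential_radialPart hα ha (ha.trans hab) hb, realPotential_smul,
    realPotential_circleMeasure zero_le_one, ENNReal.toReal_ofReal h0, h1]
  ring

end RadialMeasure

/-! ### The obstacle problem solved by the candidate -/

section Obstacle

variable {α a b σ : ℝ}

/-- With `σ = |z|²`, the two sides differ by a constant for `σ ≤ a` and agree for `b < σ ≤ α`. In
between and beyond `α`, `mul_log_sub_le` applies with `x = a` up to the unit circle, `x = b` up to
`b`, and `x = α` outside. -/
lemma discPotential_sum_le (ha : 0 ≤ a) (ha1 : a < 1) (hb1 : 1 < b) (hb : b ≤ α)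
    (h : a * (Real.log a - 1) ≤ b * (Real.log b - 1)) :
    discPotential a σ + discPotential α σ - discPotential b σ +
      (b - a) / 2 * Real.log (max σ 1) ≤ σ / 2 + α * (Real.log α - 1) / 2 := by
  unfold discPotential
  rcases le_or_gt σ a with h1 | h1
  · rw [if_pos h1, if_pos (by linarith), if_pos (by linarith), max_eq_right (by linarith),
      Real.log_one]
    linarith
  rw [if_neg (not_le.2 h1)]
  have hσ0 : 0 < σ := ha.trans_lt h1
  rcases le_or_gt σ b with h2 | h2
  · rw [if_pos (by linarith), if_pos h2]
    rcases le_or_gt σ 1 with h3 | h3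
    · rw [max_eq_right h3, Real.log_one]
      linarith [mul_log_sub_le ha hσ0]
    · rw [max_eq_left h3.le]
      linarith [mul_log_sub_le (x := b) (by linarith) hσ0]
  rw [if_neg (not_le.2 h2), max_eq_left (by linarith)]
  rcases le_or_gt σ α with h3 | h3
  · rw [if_pos h3]
    linarith
  · rw [if_neg (not_le.2 h3)]
    linarith [mul_log_sub_le (x := α) (by linarith) hσ0]

/-- The equation relating `a` and `b` matches the constants on the inner disc. If `a = 0` that disc
has no point with `σ > 0`, and no equation is required. -/
lemma discPotential_sum_eq (ha1 : a < 1) (hb1 : 1 < b) (hb : b ≤ α)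
    (h : a = 0 ∨ a * (Real.log a - 1) = b * (Real.log b - 1))
    (hσ : (0 < σ ∧ σ ≤ a) ∨ (b ≤ σ ∧ σ ≤ α)) :
    discPotential a σ + discPotential α σ - discPotential b σ +
      (b - a) / 2 * Real.log (max σ 1) = σ / 2 + α * (Real.log α - 1) / 2 := by
  unfold discPotential
  rcases hσ with ⟨h1, h2⟩ | ⟨h1, h2⟩
  · have := h.resolve_left (h1.trans_le h2).ne'
    rw [if_pos h2, if_pos (by linarith), if_pos (by linarith), max_eq_right (by linarith),
      Real.log_one]
    linarith
  · rw [if_neg (by linarith), if_pos h2, max_eq_left (by linarith)]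
    rcases h1.eq_or_lt with rfl | h1
    · rw [if_pos le_rfl]
      linarith
    · rw [if_neg (not_le.2 h1)]
      linarith

lemma discPotential_sum_one (ha1 : a < 1) (hb1 : 1 < b) (hb : b ≤ α) :
    discPotential a 1 + discPotential α 1 - discPotential b 1 +
      (b - a) / 2 * Real.log (max 1 1) =
        (α * (Real.log α - 1) - b * (Real.log b - 1)) / 2 := by
  unfold discPotential
  rw [if_neg (by linarith), if_pos (by linarith), if_pos (by linarith), max_self, Real.log_one]
  ring

lemma ae_radialPart (ha : 0 ≤ a) (hα : 0 < α) :
    ∀ᵐ z ∂radialPart α a b, (0 < ‖z‖ ^ 2 ∧ ‖z‖ ^ 2 ≤ a) ∨ (b ≤ ‖z‖ ^ 2 ∧ ‖z‖ ^ 2 ≤ α) := by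
  rw [radialPart, ae_add_measure_iff]
  constructor
  · refine Measure.ae_smul_measure ?_ _
    filter_upwards [norm_le_ae_discMeasure a, (potentialFinite_discMeasure a 0).1] with z h1 h2
    refine Or.inl ⟨?_, (Real.le_sqrt (norm_nonneg z) ha).1 h1⟩
    have := norm_pos_iff.2 h2.symm
    positivity
  · refine Measure.ae_smul_measure ?_ _
    filter_upwards [ae_restrict_mem (measurableSet_annulus _ _)] with z hz
    exact Or.inr ⟨(Real.sqrt_le_left (norm_nonneg z)).1 hz.1,
      (Real.le_sqrt (norm_nonneg z) hα.le).1 hz.2⟩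

lemma halfSup_shiftedMeasure (ha : 0 ≤ a) (ha1 : a < 1) (hb1 : 1 < b) (hb : b ≤ α)
    (h : a * (Real.log a - 1) ≤ b * (Real.log b - 1))
    (h' : a = 0 ∨ a * (Real.log a - 1) = b * (Real.log b - 1)) :
    halfSup α (shiftedMeasure α a b 1) = (Real.log α - 1) / 2 := by
  have hα : 0 < α := by linarith
  have hab : a ≤ b := by linarith
  have := isProbabilityMeasure_shiftedMeasure (t := 1) hα ha hab hb
  have hL := hasLogMoment_shiftedMeasure (a := a) (t := 1) hα hb zero_le_one
  refine le_antisymm (halfSup_le hα hL fun w _ => ?_) ?_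
  · rw [realPotential_shiftedMeasure_one hα ha hab hb]
    have := mul_le_mul_of_nonneg_left (discPotential_sum_le (σ := ‖w‖ ^ 2) ha ha1 hb1 hb h)
      (one_div_nonneg.2 hα.le)
    refine this.trans (le_of_eq ?_)
    field_simp
  -- The point `√α` lies on the contact set for every admissible `a` and `b`, so the supremum is
  -- attained there.
  · have h1 := realPotential_le_halfSup hα hL
      (potentialFinite_shiftedMeasure hα hb one_ne_zero ((√α : ℝ) : ℂ))
    have hn : ‖((√α : ℝ) : ℂ)‖ ^ 2 = α := by
      rw [Complex.norm_real, Real.norm_of_nonneg (Real.sqrt_nonneg α), Real.sq_sqrt hα.le]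
    rw [realPotential_shiftedMeasure_one hα ha hab hb, hn,
      discPotential_sum_eq ha1 hb1 hb h' (Or.inr ⟨hb, le_rfl⟩)] at h1
    have e : 1 / α * (α / 2 + α * (Real.log α - 1) / 2) = α / (2 * α) + (Real.log α - 1) / 2 := by
      field_simp
    linarith

lemma logIntegrable_shiftedMeasure_self (ha : 0 ≤ a) (hab : a ≤ b) (hb : b ≤ α) (hα : 0 < α) :
    LogIntegrable (shiftedMeasure α a b 1) (shiftedMeasure α a b 1) := by
  have := isProbabilityMeasure_shiftedMeasure (t := 1) hα ha hab hb
  have hL := hasLogMoment_shiftedMeasure (a := a) (t := 1) hα hb zero_le_one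
  exact (logIntegrable_shiftedMeasure hL hα ha hab hb (hL.logIntegrable_circleMeasure one_pos)).1

/-- The potential is integrated against the measure itself: it equals the obstacle almost everywhere
on the area part and is constant on the unit circle. -/
lemma realEnergy_shiftedMeasure_self (ha : 0 ≤ a) (ha1 : a < 1) (hb1 : 1 < b) (hb : b ≤ α)
    (h' : a = 0 ∨ a * (Real.log a - 1) = b * (Real.log b - 1)) :
    realEnergy (shiftedMeasure α a b 1) (shiftedMeasure α a b 1) =
      (Real.log α - 1) / 2 + (a ^ 2 + α ^ 2 - b ^ 2) / (4 * α ^ 2) -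
        (b - a) * (b * (Real.log b - 1)) / (2 * α ^ 2) := by
  have hα : 0 < α := by linarith
  have hab : a ≤ b := by linarith
  have hb0 : 0 ≤ b := by linarith
  have := isProbabilityMeasure_shiftedMeasure (t := 1) hα ha hab hb
  have := isFiniteMeasure_radialPart (a := a) hα hb
  have hL := hasLogMoment_shiftedMeasure (a := a) (t := 1) hα hb zero_le_one
  have hc := hL.logIntegrable_circleMeasure one_pos
  rw [(logIntegrable_shiftedMeasure hL hα ha hab hb hc).2, realEnergy_comm,
    realEnergy_comm (ν := circleMeasure 1), ← hc.symm.integral_potential,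
    ← (hL.logIntegrable_radialPart hα ha hb).symm.integral_potential]
  obtain ⟨i1, e1⟩ := integral_norm_sq_radialPart hα ha hb0 hb
  have e2 : ∫ z, realPotential (shiftedMeasure α a b 1) z ∂radialPart α a b =
      ∫ z, (‖z‖ ^ 2 / (2 * α) + (Real.log α - 1) / 2) ∂radialPart α a b := by
    refine integral_congr_ae ?_
    filter_upwards [ae_radialPart ha hα] with z hz
    rw [realPotential_shiftedMeasure_one hα ha hab hb, discPotential_sum_eq ha1 hb1 hb h' hz]
    field_simp
  have e3 : ∫ z, realPotential (shiftedMeasure α a b 1) z ∂circleMeasure 1 =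
      1 / α * ((α * (Real.log α - 1) - b * (Real.log b - 1)) / 2) := by
    have : ∀ᵐ z ∂circleMeasure 1, realPotential (shiftedMeasure α a b 1) z =
        1 / α * ((α * (Real.log α - 1) - b * (Real.log b - 1)) / 2) := by
      filter_upwards [norm_eq_ae_circleMeasure zero_le_one] with z hz
      rw [realPotential_shiftedMeasure_one hα ha hab hb, hz, one_pow,
        discPotential_sum_one ha1 hb1 hb]
    rw [integral_congr_ae this]
    simp
  rw [e2, e3, integral_add (i1.div_const _) (integrable_const _), integral_div, e1, integral_const,
    radialPart_real_univ hα ha hb0 hb, smul_eq_mul]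
  field_simp
  ring

end Obstacle

end LogEnergy
namespace LogEnergy

/-! ### Closedness and convexity of the constraint sets -/

section Families

/-- The mass of an open set is weakly lower semicontinuous. The portmanteau inequality is applied to
the identity along the trace of the neighbourhood filter on the set. -/
lemma isClosed_setOf_measure_open_le {U : Set ℂ} (hU : IsOpen U) (c : ℝ) :
    IsClosed {ν : ProbabilityMeasure ℂ | (ν : Measure ℂ).real U ≤ c} := by
  rcases lt_or_ge c 0 with hc | hc
  · convert isClosed_empty
    ext ν
    simp only [mem_ofPred_eq, mem_empty_iff_false, iff_false, not_le]
    exact hc.trans_le measureReal_nonneg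
  rw [isClosed_iff_clusterPt]
  intro μ hμ
  have hle := ProbabilityMeasure.le_liminf_measure_open_of_tendsto
    (L := nhds μ ⊓ Filter.principal {ν : ProbabilityMeasure ℂ | (ν : Measure ℂ).real U ≤ c})
    (μ := μ) (μs := id) (Filter.tendsto_id.mono_left inf_le_left) hU
  have : (nhds μ ⊓ Filter.principal {ν : ProbabilityMeasure ℂ | (ν : Measure ℂ).real U ≤ c}).NeBot :=
    hμ
  have hfr : Filter.liminf (fun ν : ProbabilityMeasure ℂ => (ν : Measure ℂ) U)
      (nhds μ ⊓ Filter.principal {ν : ProbabilityMeasure ℂ | (ν : Measure ℂ).real U ≤ c}) ≤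
        ENNReal.ofReal c := by
    refine (Filter.liminf_le_liminf (v := fun _ => ENNReal.ofReal c) ?_).trans
      (by rw [Filter.liminf_const])
    have hm : {ν : ProbabilityMeasure ℂ | (ν : Measure ℂ).real U ≤ c} ∈
      (nhds μ ⊓ Filter.principal {ν : ProbabilityMeasure ℂ | (ν : Measure ℂ).real U ≤ c}) :=
      Filter.mem_inf_of_right (Filter.mem_principal_self _)
    filter_upwards [hm] with ν hν
    exact (ENNReal.le_ofReal_iff_toReal_le (measure_ne_top _ _) hc).2 hν
  exact (ENNReal.le_ofReal_iff_toReal_le (measure_ne_top _ _) hc).1 (hle.trans hfr)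

lemma isClosed_fewFamily (α p : ℝ) : IsClosed (fewFamily α p) :=
  isClosed_setOf_measure_open_le Metric.isOpen_ball _

lemma isClosed_manyFamily (α p : ℝ) : IsClosed (manyFamily α p) := by
  convert isClosed_setOf_measure_open_le
    (Metric.isClosed_closedBall (x := (0 : ℂ)) (ε := 1)).isOpen_compl (1 - p / α) using 1
  ext ν
  simp only [manyFamily, mem_ofPred_eq]
  rw [probReal_compl_eq_one_sub Metric.isClosed_closedBall.measurableSet]
  constructor <;> intro h <;> linarith

lemma isConvexFamily_of_measureReal {S : Set ℂ} {P : ℝ → Prop} (hP : Convex ℝ {x | P x}) :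
    IsConvexFamily {ν : ProbabilityMeasure ℂ | P ((ν : Measure ℂ).real S)} := by
  rintro _ ⟨μ, hμ, rfl⟩ _ ⟨ν, hν, rfl⟩ a b - - hab
  have hp : IsProbabilityMeasure (a • (μ : Measure ℂ) + b • (ν : Measure ℂ)) := by
    refine ⟨?_⟩
    rw [Measure.add_apply, Measure.smul_apply, Measure.smul_apply, measure_univ, measure_univ]
    simpa [ENNReal.smul_def] using (by exact_mod_cast hab : (a : ℝ≥0∞) + b = 1)
  refine ⟨⟨_, hp⟩, ?_, rfl⟩
  have h := hP hμ hν a.2 b.2 (congrArg NNReal.toReal hab)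
  have e : (a • (μ : Measure ℂ) + b • (ν : Measure ℂ)).real S =
      (a : ℝ) • (μ : Measure ℂ).real S + (b : ℝ) • (ν : Measure ℂ).real S := by
    rw [measureReal_add_apply, measureReal_nnreal_smul_apply, measureReal_nnreal_smul_apply]
    rfl
  change P _
  rw [ProbabilityMeasure.coe_mk, e]
  exact h

lemma isConvexFamily_fewFamily (α p : ℝ) : IsConvexFamily (fewFamily α p) :=
  isConvexFamily_of_measureReal (P := fun x => x ≤ p / α) (convex_Iic _)

lemma isConvexFamily_manyFamily (α p : ℝ) : IsConvexFamily (manyFamily α p) :=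
  isConvexFamily_of_measureReal (P := fun x => p / α ≤ x) (convex_Ici _)

end Families

/-! ### Optimality by comparison circles -/

section Minimizers

variable {α a b : ℝ}

/-- The constrained minimization problem: the radial measure is optimal as soon as a suitable
comparison circle exists for each competitor. -/
lemma isUniqueMinimizer_of_comparison (ha : 0 ≤ a) (ha1 : a < 1) (hb1 : 1 < b) (hb : b ≤ α)
    (h : a * (Real.log a - 1) ≤ b * (Real.log b - 1))
    (h' : a = 0 ∨ a * (Real.log a - 1) = b * (Real.log b - 1))
    {C : Set (ProbabilityMeasure ℂ)} {μ : ProbabilityMeasure ℂ} (hμC : μ ∈ C)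
    (hμ : (μ : Measure ℂ) = radialMeasure α a b)
    (hcomp : ∀ ν ∈ C, HasLogMoment ν → ∃ t, 0 ≤ t ∧ LogIntegrable ν (circleMeasure t) ∧
      realEnergy ν (circleMeasure 1) - realEnergy ν (circleMeasure t) ≤
        -(b * (Real.log b - 1) + t ^ 2) / (2 * α)) :
    IsUniqueMinimizer α C μ := by
  have hα : 0 < α := by linarith
  have hab : a ≤ b := by linarith
  rw [radialMeasure_eq hα] at hμ
  have hμL : LogIntegrable μ μ := by
    rw [hμ]
    exact logIntegrable_shiftedMeasure_self ha hab hb hα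
  have hS : halfSup α μ = (Real.log α - 1) / 2 := by
    rw [hμ, halfSup_shiftedMeasure ha ha1 hb1 hb h h']
  have hE := realEnergy_shiftedMeasure_self ha ha1 hb1 hb h'
  rw [← hμ] at hE
  have key : ∀ ν ∈ C, HasLogMoment ν →
      realEnergy ν μ - halfSup α ν ≤ realEnergy μ μ - halfSup α μ := by
    intro ν hν hνL
    obtain ⟨t, ht, hc, hle⟩ := hcomp ν hν hνL
    have := isProbabilityMeasure_shiftedMeasure (t := t) hα ha hab hb
    obtain ⟨h1, e1⟩ := logIntegrable_shiftedMeasure hνL hα ha hab hb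
      (hνL.logIntegrable_circleMeasure one_pos)
    obtain ⟨h2, e2⟩ := logIntegrable_shiftedMeasure hνL hα ha hab hb hc
    obtain ⟨i3, e3⟩ := integrable_norm_sq_shiftedMeasure hα ha hab hb ht
    have h4 := realEnergy_le_halfSup hα hνL h2 i3
    rw [e2, e3] at h4
    rw [hE, hS, hμ, e1]
    have h5 := mul_le_mul_of_nonneg_left hle (div_nonneg (by linarith : 0 ≤ b - a) hα.le)
    -- The second moment of the circle of radius `t` cancels the `t ^ 2` in the comparison
    -- hypothesis. What remains is exactly `Σ(μ) - B_α(μ)/2`, so no loss occurs.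
    have e4 : (1 / α * ((a ^ 2 + α ^ 2 - b ^ 2) / 2) + (b - a) / α * t ^ 2) / (2 * α) +
        (b - a) / α * (-(b * (Real.log b - 1) + t ^ 2) / (2 * α)) =
        (a ^ 2 + α ^ 2 - b ^ 2) / (4 * α ^ 2) -
          (b - a) * (b * (Real.log b - 1)) / (2 * α ^ 2) := by
      field_simp
      ring
    linarith
  -- The left side is nonnegative and vanishes only for `ν = μ`; this yields both minimality and
  -- uniqueness.
  have diff : ∀ ν ∈ C, LogIntegrable ν ν →
      2 * realEnergy ν μ - realEnergy ν ν - realEnergy μ μ ≤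
        (2 * halfSup α ν - realEnergy ν ν) - (2 * halfSup α μ - realEnergy μ μ) := by
    intro ν hν hνL
    linarith [key ν hν hνL.hasLogMoment]
  refine ⟨⟨hμC, hμL.hasLogMoment, fun ν hν hνL => ?_⟩, fun ν hν => ?_⟩
  · by_cases hνν : LogIntegrable ν ν
    · rw [hμL.energyFunctional_eq hα, hνν.energyFunctional_eq hα, EReal.coe_le_coe_iff]
      linarith [diff ν hν hνν, realEnergy_add_le_two_mul hνν hμL]
    · rw [energyFunctional_eq_top hα hνL hνν]
      exact le_top
  · have hle := hν.2.2 μ hμC hμL.hasLogMoment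
    by_cases hνν : LogIntegrable ν ν
    · rw [hμL.energyFunctional_eq hα, hνν.energyFunctional_eq hα, EReal.coe_le_coe_iff] at hle
      have := eq_of_two_mul_realEnergy_le hνν hμL (by linarith [diff ν hν.1 hνν])
      exact Subtype.ext this
    · rw [energyFunctional_eq_top hα hν.2.1 hνν, hμL.energyFunctional_eq hα, top_le_iff] at hle
      exact absurd hle (EReal.coe_ne_top _)

lemma isProbabilityMeasure_radialMeasure (ha : 0 ≤ a) (hab : a ≤ b) (hb : b ≤ α) (hα : 0 < α) :
    IsProbabilityMeasure (radialMeasure α a b) := by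
  rw [radialMeasure_eq hα]
  exact isProbabilityMeasure_shiftedMeasure hα ha hab hb

lemma supTerm_radialMeasure (ha : 0 ≤ a) (ha1 : a < 1) (hb1 : 1 < b) (hb : b ≤ α)
    (h : a * (Real.log a - 1) ≤ b * (Real.log b - 1))
    (h' : a = 0 ∨ a * (Real.log a - 1) = b * (Real.log b - 1)) :
    supTerm α (radialMeasure α a b) = ((Real.log α - 1 : ℝ) : EReal) := by
  have hα : 0 < α := by linarith
  have hab : a ≤ b := by linarith
  have := isProbabilityMeasure_shiftedMeasure (t := 1) hα ha hab hb
  rw [radialMeasure_eq hα, supTerm_eq hα (hasLogMoment_shiftedMeasure hα hb zero_le_one),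
    halfSup_shiftedMeasure ha ha1 hb1 hb h h']
  congr 1
  ring

lemma energyFunctional_radialMeasure (ha : 0 ≤ a) (ha1 : a < 1) (hb1 : 1 < b) (hb : b ≤ α)
    (h : a * (Real.log a - 1) ≤ b * (Real.log b - 1))
    (h' : a = 0 ∨ a * (Real.log a - 1) = b * (Real.log b - 1)) :
    energyFunctional α (radialMeasure α a b) =
      ((Real.log α / 2 - 3 / 4 + b ^ 2 * (2 * Real.log b - 1) / (4 * α ^ 2)
        - a ^ 2 * (2 * Real.log a - 1) / (4 * α ^ 2) : ℝ) : EReal) := by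
  have hα : 0 < α := by linarith
  have hab : a ≤ b := by linarith
  have := isProbabilityMeasure_shiftedMeasure (t := 1) hα ha hab hb
  rw [radialMeasure_eq hα,
    (logIntegrable_shiftedMeasure_self ha hab hb hα).energyFunctional_eq hα,
    halfSup_shiftedMeasure ha ha1 hb1 hb h h', realEnergy_shiftedMeasure_self ha ha1 hb1 hb h']
  congr 1
  have e : a * (a * (Real.log a - 1)) = a * (b * (Real.log b - 1)) := by
    rcases h' with rfl | h'
    · simp
    · rw [h']
  field_simp
  linear_combination 4 * e

lemma measureReal_ball_radialMeasure_le (ha : 0 ≤ a) (hb1 : 1 < b) (hα : 0 < α) :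
    (radialMeasure α a b).real (Metric.ball 0 1) ≤ a / α := by
  have h1 : (volume.restrict {z : ℂ | √b ≤ ‖z‖ ∧ ‖z‖ ≤ √α}) (Metric.ball 0 1) = 0 := by
    rw [Measure.restrict_apply Metric.isOpen_ball.measurableSet]
    convert measure_empty (μ := (volume : Measure ℂ))
    ext z
    simp only [mem_inter_iff, mem_ball_zero_iff, mem_ofPred_eq, mem_empty_iff_false, iff_false]
    rintro ⟨h1, h2, -⟩
    have := (Real.lt_sqrt zero_le_one).2 (by simpa using hb1 : (1 : ℝ) ^ 2 < b)
    linarith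
  have h2 : circleMeasure 1 (Metric.ball 0 1) = 0 := by
    refine measure_mono_null ?_ (ae_iff.1 (norm_eq_ae_circleMeasure zero_le_one))
    intro z hz
    rw [mem_ball_zero_iff] at hz
    exact hz.ne
  have h3 : radialMeasure α a b (Metric.ball 0 1) ≤ ENNReal.ofReal (a / α) := by
    rw [radialMeasure_eq hα, shiftedMeasure, radialPart, Measure.add_apply, Measure.add_apply,
      Measure.smul_apply, Measure.smul_apply, Measure.smul_apply, h1, h2, smul_zero, smul_zero,
      add_zero, add_zero, smul_eq_mul]
    calc _ ≤ ENNReal.ofReal (1 / α) * discMeasure a univ := by gcongr; exact subset_univ _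
      _ = ENNReal.ofReal (a / α) := by
        rw [discMeasure_univ ha, ← ENNReal.ofReal_mul (by positivity)]
        congr 1
        ring
  exact ENNReal.toReal_le_of_le_ofReal (by positivity) h3

lemma le_measureReal_closedBall_radialMeasure (ha : 0 ≤ a) (ha1 : a < 1) (hab : a ≤ b)
    (hb : b ≤ α) (hα : 0 < α) :
    b / α ≤ (radialMeasure α a b).real (Metric.closedBall 0 1) := by
  have hP := isProbabilityMeasure_radialMeasure ha hab hb hα
  have h1 : discMeasure a (Metric.closedBall 0 1) = ENNReal.ofReal a := by
    rw [← discMeasure_univ ha]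
    refine measure_congr (Filter.eventuallyEq_univ.2 ?_)
    filter_upwards [norm_le_ae_discMeasure a] with z hz
    rw [mem_closedBall_zero_iff]
    exact hz.trans (Real.sqrt_le_one.2 ha1.le)
  have h2 : circleMeasure 1 (Metric.closedBall 0 1) = 1 := by
    rw [← measure_univ (μ := circleMeasure 1)]
    refine measure_congr (Filter.eventuallyEq_univ.2 ?_)
    filter_upwards [norm_eq_ae_circleMeasure zero_le_one] with z hz
    rw [mem_closedBall_zero_iff]
    exact hz.le
  rw [measureReal_def, ← ENNReal.ofReal_le_iff_le_toReal (measure_ne_top _ _),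
    radialMeasure_eq hα, shiftedMeasure, radialPart, Measure.add_apply, Measure.add_apply,
    Measure.smul_apply, Measure.smul_apply, Measure.smul_apply, h1, h2, smul_eq_mul, smul_eq_mul,
    smul_eq_mul, mul_one, ← ENNReal.ofReal_mul (by positivity)]
  calc ENNReal.ofReal (b / α) = ENNReal.ofReal (1 / α * a) + ENNReal.ofReal ((b - a) / α) := by
        rw [← ENNReal.ofReal_add (by positivity) (div_nonneg (by linarith) hα.le)]
        congr 1
        ring
    _ ≤ _ := by gcongr; exact le_self_add

lemma circleMeasure_zero : circleMeasure 0 = Measure.dirac 0 := by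
  rw [circleMeasure, circleMap_zero_radius]
  change _ • Measure.map (fun _ => (0 : ℂ)) _ = _
  rw [Measure.map_const, Measure.restrict_apply_univ, Real.volume_Ioc, smul_smul,
    ← ENNReal.ofReal_mul (by positivity), sub_zero, one_div,
    inv_mul_cancel₀ (by positivity), ENNReal.ofReal_one, one_smul]

/-- Mass outside the open unit disc stays away from the pole at the origin, and there `0 ≤ log |z| ≤
log (1 + |z|)`. -/
lemma logIntegrable_circleMeasure_zero {ν : Measure ℂ} [IsFiniteMeasure ν] (hν : HasLogMoment ν)
    (h : ∀ᵐ z ∂ν, 1 ≤ ‖z‖) : LogIntegrable ν (circleMeasure 0) := by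
  have hm : Measurable fun z : ℂ => (z, (0 : ℂ)) := by fun_prop
  rw [circleMeasure_zero]
  refine ⟨?_, ?_⟩
  · rw [Measure.prod_dirac, ae_map_iff (p := fun x : ℂ × ℂ => x.1 ≠ x.2) hm.aemeasurable
      (measurableSet_eq_fun measurable_fst measurable_snd).compl]
    filter_upwards [h] with z hz h0
    rw [h0, norm_zero] at hz
    linarith
  · rw [Measure.prod_dirac,
      integrable_map_measure measurable_log_norm_sub.aestronglyMeasurable hm.aemeasurable]
    refine Integrable.mono' hν (measurable_log_norm_sub.comp hm).aestronglyMeasurable ?_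
    filter_upwards [h] with z hz
    simp only [Function.comp, sub_zero]
    rw [Real.norm_of_nonneg (Real.log_nonneg hz)]
    exact Real.log_le_log (by linarith) (by linarith)

lemma LogIntegrable.realEnergy_circleMeasure {ν : Measure ℂ} [IsFiniteMeasure ν] {t : ℝ}
    (ht : 0 ≤ t) (h : LogIntegrable ν (circleMeasure t)) :
    Integrable (fun z : ℂ => Real.log (max ‖z‖ t)) ν ∧
    realEnergy ν (circleMeasure t) = ∫ z, Real.log (max ‖z‖ t) ∂ν := by
  rw [← h.integral_potential]
  have := h.integrable_potential
  have e : realPotential (circleMeasure t) = fun z => Real.log (max ‖z‖ t) :=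
    funext (realPotential_circleMeasure ht)
  rw [e] at this ⊢
  exact ⟨this, rfl⟩

/-- Reduces the comparison of two circles to a bound on `log (max |z| 1) - log (max |z| t)`. The
mass constraint then acts through `ν.real S`. -/
lemma realEnergy_circleMeasure_sub_le {ν : Measure ℂ} [IsFiniteMeasure ν] (hν : HasLogMoment ν)
    {t : ℝ} (ht : 0 ≤ t) (h : LogIntegrable ν (circleMeasure t)) {S : Set ℂ}
    (hS : MeasurableSet S) {c : ℝ}
    (hc : ∀ᵐ z ∂ν, Real.log (max ‖z‖ 1) - Real.log (max ‖z‖ t) ≤ S.indicator (fun _ => c) z) :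
    realEnergy ν (circleMeasure 1) - realEnergy ν (circleMeasure t) ≤ ν.real S * c := by
  obtain ⟨i1, e1⟩ := (hν.logIntegrable_circleMeasure one_pos).realEnergy_circleMeasure zero_le_one
  obtain ⟨i2, e2⟩ := h.realEnergy_circleMeasure ht
  rw [e1, e2, ← integral_sub i1 i2]
  refine (integral_mono_ae (i1.sub i2) ((integrable_const c).indicator hS) hc).trans ?_
  rw [integral_indicator hS, setIntegral_const, smul_eq_mul]

theorem isUniqueMinimizer_fewFamily (ha : 0 ≤ a) (ha1 : a < 1) (hb1 : 1 < b) (hb : b ≤ α)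
    (h : a * (Real.log a - 1) = b * (Real.log b - 1)) {μ : ProbabilityMeasure ℂ}
    (hμ : (μ : Measure ℂ) = radialMeasure α a b) : IsUniqueMinimizer α (fewFamily α a) μ := by
  have hα : 0 < α := by linarith
  refine isUniqueMinimizer_of_comparison ha ha1 hb1 hb h.le (Or.inr h) ?_ hμ fun ν hν hνL => ?_
  · change (μ : Measure ℂ).real _ ≤ _
    rw [hμ]
    exact measureReal_ball_radialMeasure_le ha hb1 hα
  replace hν : (ν : Measure ℂ).real (Metric.ball 0 1) ≤ a / α := hν
  -- The circle is moved to the edge of the inner disc. With the equation, the required bound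
  -- becomes `(a / α) * (-log a / 2)`: the allowed mass of the unit disc times the largest gain
  -- `-log √a`.
  refine ⟨√a, Real.sqrt_nonneg a, ?_⟩
  rw [Real.sq_sqrt ha, ← h]
  have hsqrt : √a ≤ 1 := Real.sqrt_le_one.2 ha1.le
  have hout : ∀ z : ℂ, 1 ≤ ‖z‖ → Real.log (max ‖z‖ 1) - Real.log (max ‖z‖ √a) = 0 := by
    intro z hz
    rw [max_eq_left hz, max_eq_left (hsqrt.trans hz), sub_self]
  rcases ha.eq_or_lt with rfl | ha0
  -- For `a = 0` the circle degenerates to the origin; the constraint leaves no mass in the open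
  -- disc, so both potentials agree almost everywhere.
  · have hae : ∀ᵐ z ∂(ν : Measure ℂ), 1 ≤ ‖z‖ := by
      have h0 : (ν : Measure ℂ).real (Metric.ball 0 1) = 0 :=
        le_antisymm (by simpa using hν) measureReal_nonneg
      rw [measureReal_eq_zero_iff] at h0
      rw [ae_iff]
      convert h0 using 2
      ext z
      simp
    have hL : LogIntegrable ν (circleMeasure √0) := by
      rw [Real.sqrt_zero]
      exact logIntegrable_circleMeasure_zero hνL hae
    refine ⟨hL, ?_⟩
    refine (realEnergy_circleMeasure_sub_le hνL (Real.sqrt_nonneg 0) hL MeasurableSet.empty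
      (c := 0) ?_).trans (by simp)
    filter_upwards [hae] with z hz
    rw [hout z hz]
    simp
  · have hs : 0 < √a := Real.sqrt_pos.2 ha0
    have hlog : 0 ≤ -(Real.log a / 2) := by linarith [Real.log_nonpos ha ha1.le]
    refine ⟨hνL.logIntegrable_circleMeasure hs, ?_⟩
    refine (realEnergy_circleMeasure_sub_le hνL hs.le (hνL.logIntegrable_circleMeasure hs)
      Metric.isOpen_ball.measurableSet (S := Metric.ball 0 1) (c := -(Real.log a / 2))
      (ae_of_all _ fun z => ?_)).trans ?_
    · by_cases hz : ‖z‖ < 1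
      · rw [indicator_of_mem (by simpa using hz), max_eq_right hz.le, Real.log_one,
          ← Real.log_sqrt ha, zero_sub, neg_le_neg_iff]
        exact Real.log_le_log hs (le_max_right _ _)
      · rw [indicator_of_notMem (by simpa using hz), hout z (not_lt.1 hz)]
    · refine (mul_le_mul_of_nonneg_right hν hlog).trans (le_of_eq ?_)
      field_simp
      ring

theorem isUniqueMinimizer_manyFamily (ha : 0 ≤ a) (ha1 : a < 1) (hb1 : 1 < b) (hb : b ≤ α)
    (h : a * (Real.log a - 1) ≤ b * (Real.log b - 1))
    (h' : a = 0 ∨ a * (Real.log a - 1) = b * (Real.log b - 1)) {μ : ProbabilityMeasure ℂ}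
    (hμ : (μ : Measure ℂ) = radialMeasure α a b) : IsUniqueMinimizer α (manyFamily α b) μ := by
  have hα : 0 < α := by linarith
  have hb0 : 0 ≤ b := by linarith
  refine isUniqueMinimizer_of_comparison ha ha1 hb1 hb h h' ?_ hμ fun ν hν hνL => ?_
  · change _ ≤ (μ : Measure ℂ).real _
    rw [hμ]
    exact le_measureReal_closedBall_radialMeasure ha ha1 (by linarith) hb hα
  replace hν : b / α ≤ (ν : Measure ℂ).real (Metric.closedBall 0 1) := hν
  have hs : 1 ≤ √b := Real.one_le_sqrt.2 hb1.le
  have hs0 : 0 < √b := by linarith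
  have hlog : 0 ≤ Real.log b / 2 := by linarith [Real.log_nonneg hb1.le]
  -- The circle is moved out to the inner edge of the annulus. On the closed disc this changes the
  -- integrand by `-log √b`, elsewhere the difference is nonpositive, and the required bound is `-(b
  -- / α) * (log b / 2)`.
  refine ⟨√b, hs0.le, hνL.logIntegrable_circleMeasure hs0, ?_⟩
  rw [Real.sq_sqrt hb0]
  refine (realEnergy_circleMeasure_sub_le hνL hs0.le (hνL.logIntegrable_circleMeasure hs0)
    Metric.isClosed_closedBall.measurableSet (S := Metric.closedBall 0 1) (c := -(Real.log b / 2))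
    (ae_of_all _ fun z => ?_)).trans ?_
  · by_cases hz : ‖z‖ ≤ 1
    · rw [indicator_of_mem (by simpa using hz), max_eq_right hz, max_eq_right (hz.trans hs),
        Real.log_one, Real.log_sqrt hb0, zero_sub]
    · rw [indicator_of_notMem (by simpa using hz), sub_nonpos]
      exact Real.log_le_log (by positivity) (max_le_max_left _ hs)
  · have := mul_le_mul_of_nonneg_right hν hlog
    have e : -(b * (Real.log b - 1) + b) / (2 * α) = -(b / α * (Real.log b / 2)) := by
      field_simp
      ring
    rw [e]
    linarith

end Minimizers

/-! ### The equation relating `p` and `q` -/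

section Equation

/-- The function `x (log x - 1)`, whose derivative is `log x`. -/
lemma hasDerivAt_mul_log_sub_one {x : ℝ} (hx : x ≠ 0) :
    HasDerivAt (fun x => x * (Real.log x - 1)) (Real.log x) x := by
  refine ((hasDerivAt_id x).mul ((Real.hasDerivAt_log hx).sub_const 1)).congr_deriv ?_
  simp only [id]
  field_simp
  ring

lemma continuous_mul_log_sub_one : Continuous fun x : ℝ => x * (Real.log x - 1) := by
  have : Continuous fun x : ℝ => x * Real.log x - x := Real.continuous_mul_log.sub continuous_id
  refine this.congr fun x => ?_
  ring

lemma strictMonoOn_mul_log_sub_one : StrictMonoOn (fun x : ℝ => x * (Real.log x - 1)) (Ici 1) := by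
  refine strictMonoOn_of_deriv_pos (convex_Ici 1) continuous_mul_log_sub_one.continuousOn ?_
  intro x hx
  rw [interior_Ici] at hx
  rw [(hasDerivAt_mul_log_sub_one (ne_of_gt (zero_lt_one.trans hx))).deriv]
  exact Real.log_pos hx

lemma strictAntiOn_mul_log_sub_one :
    StrictAntiOn (fun x : ℝ => x * (Real.log x - 1)) (Icc 0 1) := by
  refine strictAntiOn_of_deriv_neg (convex_Icc 0 1) continuous_mul_log_sub_one.continuousOn ?_
  intro x hx
  rw [interior_Icc] at hx
  rw [(hasDerivAt_mul_log_sub_one hx.1.ne').deriv]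
  exact Real.log_neg hx.1 hx.2

/-- The function `x (log x - 1)` falls from `0` at `0` to `-1` at `1`, then increases and returns to
`0` at `e`. Each level in `(-1, 0]` is thus attained exactly once beyond `1`. -/
lemma existsUnique_gt_one {p : ℝ} (hp : 0 ≤ p) (hp1 : p < 1) :
    ∃! q : ℝ, 1 < q ∧ q * (Real.log q - 1) = p * (Real.log p - 1) := by
  have h1 := strictAntiOn_mul_log_sub_one ⟨hp, hp1.le⟩ ⟨zero_le_one, le_rfl⟩ hp1
  have h2 : p * (Real.log p - 1) ≤ 0 := by
    have := strictAntiOn_mul_log_sub_one.antitoneOn ⟨le_rfl, zero_le_one⟩ ⟨hp, hp1.le⟩ hp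
    simpa using this
  have he : (1 : ℝ) ≤ Real.exp 1 := Real.one_le_exp zero_le_one
  obtain ⟨q, hq, hqe⟩ := intermediate_value_Icc he continuous_mul_log_sub_one.continuousOn
    (show p * (Real.log p - 1) ∈ Icc (1 * (Real.log 1 - 1))
      (Real.exp 1 * (Real.log (Real.exp 1) - 1)) from ⟨h1.le, by simpa using h2⟩)
  have hq1 : 1 < q := by
    refine lt_of_le_of_ne hq.1 ?_
    rintro rfl
    exact h1.ne hqe
  refine ⟨q, ⟨hq1, hqe⟩, fun r hr => ?_⟩
  exact strictMonoOn_mul_log_sub_one.injOn hr.1.le hq1.le (hr.2.trans hqe.symm)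

/-- The levels strictly between `-1` and `0` are attained exactly once on the decreasing branch, in
its interior. -/
lemma existsUnique_lt_one {p : ℝ} (hp1 : 1 < p) (hpe : p < Real.exp 1) :
    ∃! q : ℝ, 0 < q ∧ q < 1 ∧ q * (Real.log q - 1) = p * (Real.log p - 1) := by
  have h1 : 1 * (Real.log 1 - 1) < p * (Real.log p - 1) :=
    strictMonoOn_mul_log_sub_one self_mem_Ici hp1.le hp1
  have h2 : p * (Real.log p - 1) < 0 := by
    have := strictMonoOn_mul_log_sub_one hp1.le (hp1.trans hpe).le hpe
    simpa using this
  obtain ⟨q, hq, hqe⟩ := intermediate_value_Icc' zero_le_one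
    continuous_mul_log_sub_one.continuousOn
    (show p * (Real.log p - 1) ∈ Icc (1 * (Real.log 1 - 1)) (0 * (Real.log 0 - 1)) from
      ⟨h1.le, by simpa using h2.le⟩)
  have hq0 : 0 < q := by
    refine lt_of_le_of_ne hq.1 ?_
    rintro rfl
    simp only [zero_mul] at hqe
    exact h2.ne hqe.symm
  have hq1 : q < 1 := by
    refine lt_of_le_of_ne hq.2 ?_
    rintro rfl
    exact h1.ne hqe
  refine ⟨q, ⟨hq0, hq1, hqe⟩, fun r hr => ?_⟩
  exact strictAntiOn_mul_log_sub_one.injOn ⟨hr.1.le, hr.2.1.le⟩ ⟨hq0.le, hq1.le⟩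
    (hr.2.2.trans hqe.symm)

end Equation

end LogEnergy
-- Assembly of the cases
theorem mainTheorem8 :
    -- the constraint sets are closed and convex
    (∀ α p : ℝ, 0 < α → 0 ≤ p →
      IsClosed (LogEnergy.fewFamily α p) ∧ LogEnergy.IsConvexFamily (LogEnergy.fewFamily α p) ∧
      IsClosed (LogEnergy.manyFamily α p) ∧
        LogEnergy.IsConvexFamily (LogEnergy.manyFamily α p)) ∧
    -- the case `0 ≤ p < 1`
    (∀ p : ℝ, 0 ≤ p → p < 1 →
      (∃! q : ℝ, 1 < q ∧ q * (Real.log q - 1) = p * (Real.log p - 1)) ∧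
      ∀ q : ℝ, 1 < q → q * (Real.log q - 1) = p * (Real.log p - 1) → ∀ α : ℝ, q ≤ α →
        ∃ μ : MeasureTheory.ProbabilityMeasure ℂ,
          (μ : MeasureTheory.Measure ℂ) = LogEnergy.radialMeasure α p q ∧
          LogEnergy.IsUniqueMinimizer α (LogEnergy.fewFamily α p) μ ∧
          LogEnergy.supTerm α μ = ((Real.log α - 1 : ℝ) : EReal) ∧
          LogEnergy.energyFunctional α μ =
            ((Real.log α / 2 - 3 / 4 + q ^ 2 * (2 * Real.log q - 1) / (4 * α ^ 2)
              - p ^ 2 * (2 * Real.log p - 1) / (4 * α ^ 2) : ℝ) : EReal)) ∧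
    -- the case `1 < p < e`
    (∀ p : ℝ, 1 < p → p < Real.exp 1 →
      (∃! q : ℝ, 0 < q ∧ q < 1 ∧ q * (Real.log q - 1) = p * (Real.log p - 1)) ∧
      ∀ q : ℝ, 0 < q → q < 1 → q * (Real.log q - 1) = p * (Real.log p - 1) → ∀ α : ℝ, p < α →
        ∃ μ : MeasureTheory.ProbabilityMeasure ℂ,
          (μ : MeasureTheory.Measure ℂ) = LogEnergy.radialMeasure α q p ∧
          LogEnergy.IsUniqueMinimizer α (LogEnergy.manyFamily α p) μ ∧
          LogEnergy.energyFunctional α μ =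
            ((Real.log α / 2 - 3 / 4 + p ^ 2 * (2 * Real.log p - 1) / (4 * α ^ 2)
              - q ^ 2 * (2 * Real.log q - 1) / (4 * α ^ 2) : ℝ) : EReal)) ∧
    -- the case `e ≤ p < α`
    (∀ p α : ℝ, Real.exp 1 ≤ p → p < α →
      ∃ μ : MeasureTheory.ProbabilityMeasure ℂ,
        (μ : MeasureTheory.Measure ℂ) = LogEnergy.radialMeasure α 0 p ∧
        LogEnergy.IsUniqueMinimizer α (LogEnergy.manyFamily α p) μ ∧
        LogEnergy.energyFunctional α μ =
          ((Real.log α / 2 - 3 / 4 + p ^ 2 * (2 * Real.log p - 1) / (4 * α ^ 2) : ℝ) : EReal)) ∧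
    -- variational characterization of minimizers over closed convex sets, and the energy bound
    (∀ (α : ℝ) (C : Set (MeasureTheory.ProbabilityMeasure ℂ))
      (μmin : MeasureTheory.ProbabilityMeasure ℂ), 0 < α → IsClosed C →
      LogEnergy.IsConvexFamily C → LogEnergy.IsMinimizer α C μmin →
      LogEnergy.FiniteLogEnergy μmin →
        (∀ μ ∈ C, LogEnergy.FiniteLogEnergy μ →
          ((∀ ν ∈ C, LogEnergy.FiniteLogEnergy ν →
              LogEnergy.eintegral μ (LogEnergy.logPotential ν) - LogEnergy.supTerm α ν / 2 ≤
              LogEnergy.eintegral μ (LogEnergy.logPotential μ) - LogEnergy.supTerm α μ / 2) ↔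
            μ = μmin)) ∧
        (∀ ν ∈ C, LogEnergy.HasLogMoment ν →
          -LogEnergy.signedLogEnergy
              ((ν : MeasureTheory.Measure ℂ).toSignedMeasure -
                (μmin : MeasureTheory.Measure ℂ).toSignedMeasure) ≤
            LogEnergy.energyFunctional α ν - LogEnergy.energyFunctional α μmin)) := by

  open LogEnergy in
  refine ⟨fun α p _ _ => ⟨isClosed_fewFamily α p, isConvexFamily_fewFamily α p,
    isClosed_manyFamily α p, isConvexFamily_manyFamily α p⟩, ?_, ?_, ?_, ?_⟩
  · refine fun p hp hp1 => ⟨existsUnique_gt_one hp hp1, fun q hq hpq α hα => ?_⟩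
    exact ⟨⟨_, isProbabilityMeasure_radialMeasure hp (by linarith) hα (by linarith)⟩, rfl,
      isUniqueMinimizer_fewFamily hp hp1 hq hα hpq.symm rfl,
      supTerm_radialMeasure hp hp1 hq hα hpq.ge (Or.inr hpq.symm),
      energyFunctional_radialMeasure hp hp1 hq hα hpq.ge (Or.inr hpq.symm)⟩
  · refine fun p hp hpe => ⟨existsUnique_lt_one hp hpe, fun q hq0 hq1 hpq α hα => ?_⟩
    exact ⟨⟨_, isProbabilityMeasure_radialMeasure hq0.le (by linarith) hα.le (by linarith)⟩, rfl,
      isUniqueMinimizer_manyFamily hq0.le hq1 hp hα.le hpq.le (Or.inr hpq) rfl,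
      energyFunctional_radialMeasure hq0.le hq1 hp hα.le hpq.le (Or.inr hpq)⟩
  · intro p α hp hα
    have hp1 : 1 < p := (Real.one_lt_exp_iff.2 one_pos).trans_le hp
    -- For `p ≥ e` one has `log p ≥ 1`, so the obstacle inequality at the origin holds with no inner
    -- disc.
    have hle : (0 : ℝ) * (Real.log 0 - 1) ≤ p * (Real.log p - 1) := by
      rw [zero_mul]
      have := (Real.le_log_iff_exp_le (by linarith)).2 hp
      exact mul_nonneg (by linarith) (by linarith)
    refine ⟨⟨_, isProbabilityMeasure_radialMeasure le_rfl (by linarith) hα.le (by linarith)⟩, rfl,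
      isUniqueMinimizer_manyFamily le_rfl one_pos hp1 hα.le hle (Or.inl rfl) rfl, ?_⟩
    have h := energyFunctional_radialMeasure le_rfl one_pos hp1 hα.le hle (Or.inl rfl)
    simp only [ne_eq, OfNat.ofNat_ne_zero, not_false_eq_true, zero_pow, zero_mul, zero_div,
      sub_zero] at h
    exact h
  · intro α C μmin hα _ hC hmin hfin
    exact ⟨fun μ hμ hμfin => variational_characterization hα hC hmin hfin.logIntegrable hμ
      hμfin.logIntegrable, fun ν hν hνL =>
      neg_signedLogEnergy_le hα hC hmin hfin.logIntegrable hν hνL⟩
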